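/- Let $0<\alpha\le\beta<1$. Let $\mathcal M$ be the set of measurable profiles $m:[0,1]\to[0,1]$ (identified when equal almost everywhere) and $\mathcal M_+\subset\mathcal M$ the set of step profiles $\mathbf 1\{[0,x_0]\}$, $x_0\in[0,1]$. Put $s(\theta)=\theta\log\theta+(1-\theta)\log(1-\theta)$ (with $0\log 0=0$) and $\mathbb S(m)=-\int_0^1 s(m(x))\,dx$. For each $m\in\mathcal M$ there is a unique increasing $F\in C^1([0,1])$, with $F'$ absolutely continuous, such that $$F''=(m-F)\,\frac{(F')^2}{F(1-F)}\ \text{ a.e. on }[0,1],\qquad F(0)=\alpha,\quad F(1)=\beta .$$ If $\alpha<\beta$, let $$V(m)=\int_0^1\Big\{m\log\frac{m}{F}+(1-m)\log\frac{1-m}{1-F}+\log\frac{F'}{\beta-\alpha}\Big\}\,dx,\qquad E_+=\log\Big(\frac1{\beta-\alpha}\int_\alpha^\beta\frac{dx}{\min\{x,1-x\}}\Big),$$ and if $\alpha=\beta$, let $$V(m)=\int_0^1\Big\{m\log\frac{m}{\alpha}+(1-m)\log\frac{1-m}{1-\alpha}\Big\}\,dx,\qquad E_+=-\log\min\{\alpha,1-\alpha\}.$$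 Then $$\sup_{m\in\mathcal M}\{V(m)+\mathbb S(m)\}=\sup_{m\in\mathcal M_+}\{V(m)+\mathbb S(m)\}=E_+ ,$$ and the supremum is attained at a profile in $\mathcal M_+$. Unless $\alpha=\beta=1/2$, this profile is unique: it is the only maximizer in $\mathcal M_+$ and, up to equality almost everywhere, the only maximizer in $\mathcal M$. -/

import Mathlib

open MeasureTheory Set

noncomputable section

/-- The set of density profiles: measurable `m : [0,1] → [0,1]`. A profile is represented by a
measurable function on `ℝ` of which only the restriction to `[0,1]` is ever used. -/
def profiles : Set (ℝ → ℝ) :=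
  {m | Measurable m ∧ ∀ x ∈ Icc (0 : ℝ) 1, m x ∈ Icc (0 : ℝ) 1}

/-- The set of decreasing step profiles `1{[0, x₀]}`, `x₀ ∈ [0,1]`. -/
def stepProfiles : Set (ℝ → ℝ) :=
  {m | ∃ x₀ ∈ Icc (0 : ℝ) 1, m = (Icc 0 x₀).indicator (fun _ => (1 : ℝ))}

/-- `s θ = θ log θ + (1 - θ) log (1 - θ)`, with `0 log 0 = 0`. -/
def entropyDensity (θ : ℝ) : ℝ :=
  θ * Real.log θ + (1 - θ) * Real.log (1 - θ)

/-- The Gibbs-Shannon entropy of a profile, `- ∫₀¹ s (m x) dx`. -/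
def profileEntropy (m : ℝ → ℝ) : ℝ :=
  - ∫ x in (0 : ℝ)..1, entropyDensity (m x)

/-- The derivative of a function on `[0,1]` (one-sided at the end points). -/
def derivUnit (F : ℝ → ℝ) : ℝ → ℝ := derivWithin F (Icc 0 1)

/-- `F ∈ C¹([0,1])` is an increasing solution of the boundary value problem
`F'' = (m - F) (F')² / (F (1 - F))`, `F 0 = α`, `F 1 = β`. As `m` is only measurable, the
equation is understood in the usual (Carathéodory) sense: `F'` is absolutely continuous and the
equation holds almost everywhere on `[0,1]`. -/
structure IsBVPSolution (α β : ℝ) (m F : ℝ → ℝ) : Prop where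
  contDiffOn : ContDiffOn ℝ 1 F (Icc 0 1)
  monotoneOn : MonotoneOn F (Icc 0 1)
  deriv_ac : AbsolutelyContinuousOnInterval (derivUnit F) 0 1
  equation : ∀ᵐ x ∂(volume.restrict (Icc (0 : ℝ) 1)),
    HasDerivAt (derivUnit F) ((m x - F x) * (derivUnit F x) ^ 2 / (F x * (1 - F x))) x
  left_bdry : F 0 = α
  right_bdry : F 1 = β

/-- The increasing solution `F` of the boundary value problem associated with `m`. -/
def bvpSolution (α β : ℝ) (m : ℝ → ℝ) : ℝ → ℝ :=
  Classical.epsilon (IsBVPSolution α β m)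

/-- The free energy `V(m)`. For `α ≠ β` it is the nonequilibrium free energy
`∫₀¹ m log (m / F) + (1 - m) log ((1 - m) / (1 - F)) + log (F' / (β - α))`, with `F` the increasing
solution of the boundary value problem. At equilibrium, `α = β`, one has `F = α`, the term
`log (F' / (β - α))` is absent, and `V(m)` is the relative entropy with respect to the
Bernoulli product measure of density `α`. -/
def freeEnergy (α β : ℝ) (m : ℝ → ℝ) : ℝ :=
  if α = β then
    ∫ x in (0 : ℝ)..1,
      (m x * Real.log (m x / α) + (1 - m x) * Real.log ((1 - m x) / (1 - α)))
  else
    ∫ x in (0 : ℝ)..1,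
      (m x * Real.log (m x / bvpSolution α β m x)
        + (1 - m x) * Real.log ((1 - m x) / (1 - bvpSolution α β m x))
        + Real.log (derivUnit (bvpSolution α β m) x / (β - α)))

/-- The energy of a profile, `V(m) + S(m)`. -/
def profileEnergy (α β : ℝ) (m : ℝ → ℝ) : ℝ :=
  freeEnergy α β m + profileEntropy m

/-- The upper end `E₊` of the energy band: `log ((β - α)⁻¹ ∫_α^β dx / min {x, 1 - x})` for
`α ≠ β`, and `- log (min {α, 1 - α})` at equilibrium `α = β`. -/
def energyMax (α β : ℝ) : ℝ :=
  if α = β then - Real.log (min α (1 - α))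
  else Real.log ((1 / (β - α)) * ∫ x in α..β, 1 / min x (1 - x))

end

/-!
For `α < β` the maximization needs no variational principle. Adding the entropy cancels the terms
`m log m` and `(1 - m) log (1 - m)`, which leaves
`(V + S)(m) = ∫ log (F' / (β - α)) - m log F - (1 - m) log (1 - F)` (`integral_add_profileEntropy`,
`IsBVPSolution.profileEnergy_eq`). Since `m log F + (1 - m) log (1 - F) ≥ log (min (F, 1 - F))`,
Jensen's inequality and the change of variables `y = F x` bound this by `E₊`. Quantitatively, with
`K = ∫_α^β dx / min (x, 1 - x)` and `g = F' / (K min (F, 1 - F))`, which has integral one,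
`E₊ - (V + S)(m)` is the integral of the nonnegative function `energyDefect`, a sum of the gap in
the first inequality and of `g - 1 - log g` (`IsBVPSolution.energyMax_sub_profileEnergy`).

Equality holds exactly if `F' = K min (F, 1 - F)` and `m` is the indicator function of `F < 1/2`. The
first condition is an autonomous equation, which with `F 0 = α` determines one curve
(`exists_extremal`); this curve does reach `β` at `1` and does solve the boundary value problem of
its own step (`isBVPSolution_extremal`). Hence the step is the only maximizer
(`exists_step_maximizer_of_lt`). For `α = β` only the first gap is present; unless `α = 1/2`,
it vanishes almost everywhere only if `m` is almost everywhere `1` (`α < 1/2`) or `0` (`α > 1/2`).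

For the boundary value problem put `φ = log (F / (1 - F))` and `w = 1 / φ' = F (1 - F) / F'`. The
equation turns into `φ' = 1 / w`, `w' = 1 - m - F`. With a primitive of `1 - m` split off from `w`
this is a system with a vector field that is continuous in `x` and Lipschitz away from `w = 0`. It
is solved by shooting in the initial value of `w` (`exists_shooting_solution`), and the a priori
bound `w > exp (φ 0 - φ 1)` keeps solutions away from the singularity. Two solutions coincide because
`(w₁ - w₂) (φ₁ - φ₂)` is decreasing and vanishes at both end points (`IsBVPSolution.eqOn`).
-/

open Filter Topology

/-! ### Shooting -/

/-- The system `p' = 1 / (v + M)`, `v' = -sigmoid p`, with the denominator cut off at `δ` so that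
the vector field is bounded and globally Lipschitz. Its solution on `[0,1]` with `p 0 = a`,
`v 0 = c` is written `p c`, `v c`; the end value `p c 1` depends continuously on `c`. -/
theorem exists_flow_truncated {M : ℝ → ℝ} (hMc : ContinuousOn M (Icc 0 1)) (a : ℝ) {δ r : ℝ}
    (hδ : 0 < δ) (hr : 0 ≤ r) :
    ∃ p v : ℝ → ℝ → ℝ, ContinuousOn (fun c => p c 1) (Icc 0 r) ∧
      ∀ c ∈ Icc 0 r, p c 0 = a ∧ v c 0 = c ∧ ∀ x ∈ Icc (0 : ℝ) 1,
        HasDerivWithinAt (p c) (1 / max (v c x + M x) δ) (Icc 0 1) x ∧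
        HasDerivWithinAt (v c) (-Real.sigmoid (p c x)) (Icc 0 1) x := by
  let f : ℝ → ℝ × ℝ → ℝ × ℝ := fun x z => (1 / max (z.2 + M x) δ, -Real.sigmoid z.1)
  have hpos : ∀ t : ℝ, 0 < max t δ := fun t => lt_max_of_lt_right hδ
  have hlip1 : LipschitzWith 1 Real.sigmoid := by
    apply lipschitzWith_of_nnnorm_deriv_le differentiable_sigmoid
    intro x
    rw [← NNReal.coe_le_coe, coe_nnnorm, Real.deriv_sigmoid, Real.norm_eq_abs, abs_le]
    have h1 := Real.sigmoid_pos x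
    have h2 := Real.sigmoid_lt_one x
    constructor <;> simp only [NNReal.coe_one] <;> nlinarith
  have hlip2 : ∀ s t : ℝ, |1 / max s δ - 1 / max t δ| ≤ (1 / δ ^ 2) * |s - t| := by
    intro s t
    have hs := hpos s
    have ht := hpos t
    rw [div_sub_div _ _ hs.ne' ht.ne', abs_div, abs_of_pos (mul_pos hs ht), one_mul, mul_one,
      div_mul_eq_mul_div, one_mul]
    have : |max t δ - max s δ| ≤ |s - t| := by
      rw [abs_sub_comm s t]; exact abs_max_sub_max_le_abs _ _ _
    gcongr
    nlinarith [le_max_right s δ, le_max_right t δ]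
  set K : NNReal := ⟨max (1 / δ ^ 2) 1, by positivity⟩
  set L : NNReal := ⟨max (1 / δ) 1, by positivity⟩
  let r' : NNReal := ⟨r, hr⟩
  have hPL : IsPicardLindelof f (tmin := 0) (tmax := 1) ⟨0, by simp⟩ (a, (0 : ℝ)) (L + r') r' L K :=
    { lipschitzOnWith := by
        intro t _
        refine LipschitzOnWith.of_dist_le_mul fun z _ z' _ => ?_
        simp only [f, Prod.dist_eq, Real.dist_eq]
        have hm : 0 ≤ max |z.1 - z'.1| |z.2 - z'.2| := by positivity
        have hKc : (K : ℝ) = max (1 / δ ^ 2) 1 := rfl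
        apply max_le
        · refine (hlip2 _ _).trans ?_
          rw [add_sub_add_right_eq_sub, hKc]
          gcongr
          · exact le_max_left _ _
          · exact le_max_right _ _
        · have h := hlip1.dist_le_mul z.1 z'.1
          rw [Real.dist_eq, Real.dist_eq, NNReal.coe_one] at h
          rw [neg_sub_neg, abs_sub_comm, hKc]
          refine h.trans ?_
          gcongr
          · exact le_max_right _ _
          · exact le_max_left _ _
      continuousOn := by
        intro z _
        simp only [f]
        refine ContinuousOn.prodMk ?_ continuousOn_const
        exact continuousOn_const.div ((continuousOn_const.add hMc).sup continuousOn_const)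
          fun x _ => (hpos _).ne'
      norm_le := by
        intro t _ z _
        simp only [f, Prod.norm_def, Real.norm_eq_abs]
        have hLc : (L : ℝ) = max (1 / δ) 1 := rfl
        rw [hLc]
        apply max_le_max
        · rw [abs_of_pos (by have := hpos (z.2 + M t); positivity)]
          exact one_div_le_one_div_of_le hδ (le_max_right _ _)
        · rw [abs_neg, abs_of_pos (Real.sigmoid_pos _)]
          exact Real.sigmoid_le_one _
      mul_max_le := by simp }
  obtain ⟨φ, h1, C, h2⟩ := hPL.exists_forall_mem_closedBall_eq_hasDerivWithinAt_lipschitzOnWith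
  have hmem : ∀ c ∈ Icc 0 r, ((a, c) : ℝ × ℝ) ∈ Metric.closedBall (a, (0 : ℝ)) r' := by
    intro c hc
    rw [Metric.mem_closedBall, Prod.dist_eq]
    simp only [dist_self, Real.dist_eq, sub_zero, abs_of_nonneg hc.1]
    exact max_le hr hc.2
  refine ⟨fun c x => (φ (a, c) x).1, fun c x => (φ (a, c) x).2, ?_, fun c hc => ?_⟩
  · refine continuous_fst.comp_continuousOn ?_
    exact (h2 1 (by simp)).continuousOn.comp (by fun_prop) hmem
  · obtain ⟨h0, h3⟩ := h1 _ (hmem c hc)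
    refine ⟨congrArg Prod.fst h0, congrArg Prod.snd h0, fun x hx => ⟨?_, ?_⟩⟩
    · exact ((hasFDerivAt_fst (𝕜 := ℝ) (E := ℝ) (F := ℝ)).comp_hasDerivWithinAt x (h3 x hx) :)
    · exact ((hasFDerivAt_snd (𝕜 := ℝ) (E := ℝ) (F := ℝ)).comp_hasDerivWithinAt x (h3 x hx) :)

theorem monotoneOn_Icc_of_hasDerivWithinAt {f f' : ℝ → ℝ} {a b : ℝ}
    (hf : ∀ x ∈ Icc a b, HasDerivWithinAt f (f' x) (Icc a b) x)
    (hf' : ∀ x ∈ Icc a b, 0 ≤ f' x) : MonotoneOn f (Icc a b) :=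
  monotoneOn_of_hasDerivWithinAt_nonneg (convex_Icc a b) (fun x hx => (hf x hx).continuousWithinAt)
    (fun x hx => (hf x (interior_subset hx)).mono interior_subset)
    fun x hx => hf' x (interior_subset hx)

/-- If `p' = 1 / W` and `W` is `1`-Lipschitz, then `p' t ≥ 1 / (W x + |x - t|)`. Integrating over
`[0, x]` and over `[x, 1]` bounds the increments of `p` from below in terms of `W x` alone. -/
theorem add_div_le_exp_sub_of_deriv {p W : ℝ → ℝ}
    (hW : ∀ x ∈ Icc (0 : ℝ) 1, 0 < W x)
    (hWlip : ∀ x ∈ Icc (0 : ℝ) 1, ∀ y ∈ Icc (0 : ℝ) 1, W x ≤ W y + |x - y|)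
    (hp : ∀ x ∈ Icc (0 : ℝ) 1, HasDerivWithinAt p (1 / W x) (Icc 0 1) x)
    {x : ℝ} (hx : x ∈ Icc (0 : ℝ) 1) :
    (W x + x) / W x ≤ Real.exp (p x - p 0) ∧ (W x + (1 - x)) / W x ≤ Real.exp (p 1 - p x) := by
  have hWx := hW x hx
  constructor
  · have hmono : MonotoneOn (fun t => p t + Real.log (W x + (x - t))) (Icc 0 x) := by
      refine monotoneOn_Icc_of_hasDerivWithinAt
        (f' := fun t => 1 / W t + (-1) / (W x + (x - t))) (fun t ht => ?_) (fun t ht => ?_)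
      · have hts : t ∈ Icc (0 : ℝ) 1 := ⟨ht.1, ht.2.trans hx.2⟩
        refine ((hp t hts).mono (Icc_subset_Icc_right hx.2)).add ?_
        refine HasDerivWithinAt.log ?_ (by linarith [ht.2])
        simpa using (((hasDerivAt_id t).const_sub x).const_add (W x)).hasDerivWithinAt
      · have hts : t ∈ Icc (0 : ℝ) 1 := ⟨ht.1, ht.2.trans hx.2⟩
        have h := hWlip t hts x hx
        rw [abs_sub_comm, abs_of_nonneg (by linarith [ht.2])] at h
        have := one_div_le_one_div_of_le (hW t hts) h
        rw [neg_div]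
        linarith
    have h := hmono ⟨le_rfl, hx.1⟩ ⟨hx.1, le_rfl⟩ hx.1
    simp only [sub_zero, sub_self, add_zero] at h
    rw [← Real.exp_log (div_pos (by linarith [hx.1] : 0 < W x + x) hWx),
      Real.log_div (by linarith [hx.1]) hWx.ne', Real.exp_le_exp]
    linarith
  · have hmono : MonotoneOn (fun t => p t - Real.log (W x + (t - x))) (Icc x 1) := by
      refine monotoneOn_Icc_of_hasDerivWithinAt
        (f' := fun t => 1 / W t - 1 / (W x + (t - x))) (fun t ht => ?_) (fun t ht => ?_)
      · have hts : t ∈ Icc (0 : ℝ) 1 := ⟨hx.1.trans ht.1, ht.2⟩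
        refine ((hp t hts).mono (Icc_subset_Icc_left hx.1)).sub ?_
        refine HasDerivWithinAt.log ?_ (by linarith [ht.1])
        simpa using (((hasDerivAt_id t).sub_const x).const_add (W x)).hasDerivWithinAt
      · have hts : t ∈ Icc (0 : ℝ) 1 := ⟨hx.1.trans ht.1, ht.2⟩
        have h := hWlip t hts x hx
        rw [abs_of_nonneg (by linarith [ht.1])] at h
        have := one_div_le_one_div_of_le (hW t hts) h
        linarith
    have h := hmono ⟨le_rfl, hx.2⟩ ⟨hx.2, le_rfl⟩ hx.2
    simp only [sub_self, add_zero] at h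
    rw [← Real.exp_log (div_pos (by linarith [hx.2] : 0 < W x + (1 - x)) hWx),
      Real.log_div (by linarith [hx.2]) hWx.ne', Real.exp_le_exp]
    linarith

/-- The boundary value problem `p' = 1 / (v + M)`, `v' = -sigmoid p`, `p 0 = a`, `p 1 = b`. The
initial value `v 0` is found by the intermediate value theorem in the truncated system. -/
theorem exists_shooting_solution {M : ℝ → ℝ} (hM0 : M 0 = 0)
    (hM : ∀ x ∈ Icc (0 : ℝ) 1, ∀ y ∈ Icc (0 : ℝ) 1, x ≤ y → 0 ≤ M y - M x ∧ M y - M x ≤ y - x)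
    {a b : ℝ} (hab : a < b) :
    ∃ p v : ℝ → ℝ, p 0 = a ∧ p 1 = b ∧ ∀ x ∈ Icc (0 : ℝ) 1, 0 < v x + M x ∧
        HasDerivWithinAt p (1 / (v x + M x)) (Icc 0 1) x ∧
        HasDerivWithinAt v (-Real.sigmoid (p x)) (Icc 0 1) x := by
  -- For `p 1 = b` the two bounds of `add_div_le_exp_sub_of_deriv`, multiplied, give
  -- `1 + 1 / W x ≤ exp (b - a)` and so `W x > exp (-(b - a))`: this is the truncation level.
  set δ := Real.exp (-(b - a)) with hδdef
  have hδ : 0 < δ := Real.exp_pos _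
  have hδ1 : δ < 1 := by rw [hδdef, Real.exp_lt_one_iff]; linarith
  have hδe : δ * Real.exp (b - a) = 1 := by rw [hδdef, ← Real.exp_add]; simp
  have hba : 0 < b - a := sub_pos.2 hab
  set r := 1 + 1 / (b - a) with hr
  have hr1 : 1 ≤ r := by rw [hr]; have : 0 < 1 / (b - a) := by positivity
                         linarith
  have hMc : ContinuousOn M (Icc 0 1) := by
    refine LipschitzOnWith.continuousOn (K := 1) (LipschitzOnWith.of_dist_le_mul fun x hx y hy => ?_)
    rw [Real.dist_eq, Real.dist_eq, NNReal.coe_one, one_mul]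
    rcases le_total x y with h | h
    · have := hM x hx y hy h
      rw [abs_sub_comm, abs_sub_comm x, abs_of_nonneg this.1, abs_of_nonneg (by linarith)]
      exact this.2
    · have := hM y hy x hx h
      rw [abs_of_nonneg this.1, abs_of_nonneg (by linarith)]
      exact this.2
  obtain ⟨p, v, hcont, hpv⟩ := exists_flow_truncated hMc a hδ (r := r) (by linarith)
  have h0 : (0 : ℝ) ∈ Icc (0 : ℝ) 1 := by simp
  have h1 : (1 : ℝ) ∈ Icc (0 : ℝ) 1 := by simp
  -- `v` decreases, at rate at most one
  have hv : ∀ c ∈ Icc 0 r, ∀ x ∈ Icc (0 : ℝ) 1, ∀ y ∈ Icc (0 : ℝ) 1, x ≤ y →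
      v c y ≤ v c x ∧ v c x - (y - x) ≤ v c y := by
    intro c hc x hx y hy hxy
    constructor
    · have hm : MonotoneOn (fun t => -v c t) (Icc 0 1) :=
        monotoneOn_Icc_of_hasDerivWithinAt (fun t ht => (((hpv c hc).2.2 t ht).2).neg)
          fun t _ => by have := Real.sigmoid_pos (p c t); linarith
      have := hm hx hy hxy
      simp only at this
      linarith
    · have hm : MonotoneOn (fun t => v c t + t) (Icc 0 1) :=
        monotoneOn_Icc_of_hasDerivWithinAt
          (fun t ht => (((hpv c hc).2.2 t ht).2).add (hasDerivWithinAt_id t _))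
          fun t _ => by have := Real.sigmoid_lt_one (p c t); linarith
      have := hm hx hy hxy
      simp only at this
      linarith
  have hpos : ∀ t : ℝ, 0 < max t δ := fun t => lt_max_of_lt_right hδ
  have hWlip : ∀ c ∈ Icc 0 r, ∀ x ∈ Icc (0 : ℝ) 1, ∀ y ∈ Icc (0 : ℝ) 1,
      max (v c x + M x) δ ≤ max (v c y + M y) δ + |x - y| := by
    intro c hc x hx y hy
    have key : v c x + M x ≤ v c y + M y + |x - y| := by
      rcases le_total x y with h | h
      · rw [abs_sub_comm, abs_of_nonneg (by linarith)]
        linarith [(hv c hc x hx y hy h).2, (hM x hx y hy h).1]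
      · rw [abs_of_nonneg (by linarith)]
        linarith [(hv c hc y hy x hx h).1, (hM y hy x hx h).2]
    apply max_le
    · linarith [le_max_left (v c y + M y) δ]
    · linarith [le_max_right (v c y + M y) δ, abs_nonneg (x - y)]
  have hbound := fun c (hc : c ∈ Icc 0 r) x (hx : x ∈ Icc (0 : ℝ) 1) =>
    add_div_le_exp_sub_of_deriv (fun x _ => hpos (v c x + M x)) (hWlip c hc)
      (fun x hx => ((hpv c hc).2.2 x hx).1) hx
  -- starting from the truncation level the solution overshoots
  have hδr : δ ∈ Icc 0 r := ⟨hδ.le, by linarith⟩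
  have hlow : b ≤ p δ 1 := by
    have h := (hbound δ hδr 0 h0).2
    rw [(hpv δ hδr).1, (hpv δ hδr).2.1, hM0] at h
    simp only [add_zero, max_self, sub_zero] at h
    have h2 : Real.exp (b - a) ≤ Real.exp (p δ 1 - a) := by
      refine le_trans ?_ h
      rw [le_div_iff₀ hδ, mul_comm, hδe]
      linarith
    linarith [Real.exp_le_exp.1 h2]
  -- a large initial speed makes it undershoot
  have hrr : r ∈ Icc 0 r := ⟨by linarith, le_rfl⟩
  have hhigh : p r 1 ≤ b := by
    have hm : MonotoneOn (fun t => (b - a) * t - p r t) (Icc 0 1) := by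
      refine monotoneOn_Icc_of_hasDerivWithinAt
        (fun t ht => ((hasDerivWithinAt_id t _).const_mul (b - a)).sub ((hpv r hrr).2.2 t ht).1)
        fun t ht => ?_
      have hvt : 1 / (b - a) ≤ v r t + M t := by
        have e1 := (hv r hrr 0 h0 t ht ht.1).2
        have e2 := (hM 0 h0 t ht ht.1).1
        rw [(hpv r hrr).2.1] at e1
        linarith [ht.2]
      have := one_div_le_one_div_of_le (by positivity) (hvt.trans (le_max_left _ δ))
      rw [one_div_one_div] at this
      linarith
    have := hm h0 h1 zero_le_one
    simp only [(hpv r hrr).1] at this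
    linarith
  obtain ⟨c, hc, hcb⟩ := intermediate_value_Icc' hδr.2
    (hcont.mono (Icc_subset_Icc_left hδ.le)) ⟨hhigh, hlow⟩
  have hcr : c ∈ Icc 0 r := ⟨hδ.le.trans hc.1, hc.2⟩
  refine ⟨p c, v c, (hpv c hcr).1, hcb, fun x hx => ?_⟩
  -- the truncation is never active
  have hW : δ < v c x + M x := by
    obtain ⟨e1, e2⟩ := hbound c hcr x hx
    set W := max (v c x + M x) δ with hWdef
    have hWp : 0 < W := hpos _
    have e3 : (W + 1) / W ≤ Real.exp (b - a) := by
      have : Real.exp (b - a) = Real.exp (p c x - p c 0) * Real.exp (p c 1 - p c x) := by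
        rw [← Real.exp_add, (hpv c hcr).1]
        simp only at hcb
        rw [hcb]; ring_nf
      rw [this]
      refine le_trans ?_ (mul_le_mul e1 e2 ?_ (Real.exp_pos _).le)
      · rw [div_mul_div_comm, div_le_div_iff₀ hWp (by positivity)]
        nlinarith [mul_nonneg hx.1 (sub_nonneg.2 hx.2)]
      · have := hx.2
        have : 0 ≤ 1 - x := by linarith
        positivity
    rw [div_le_iff₀ hWp] at e3
    have e4 : δ < W := by
      by_contra hcon
      have := mul_le_mul_of_nonneg_right (not_lt.1 hcon) (Real.exp_pos (b - a)).le
      rw [hδe] at this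
      linarith
    exact (lt_max_iff.1 e4).resolve_right (lt_irrefl _)
  have hmax : max (v c x + M x) δ = v c x + M x := max_eq_left hW.le
  refine ⟨hδ.trans hW, ?_, ((hpv c hcr).2.2 x hx).2⟩
  rw [← hmax]
  exact ((hpv c hcr).2.2 x hx).1

/-! ### Absolutely continuous functions -/

namespace AbsolutelyContinuousOnInterval

theorem congr_uIcc {f g : ℝ → ℝ} {a b : ℝ} (hf : AbsolutelyContinuousOnInterval f a b)
    (hfg : EqOn f g (uIcc a b)) : AbsolutelyContinuousOnInterval g a b := by
  rw [absolutelyContinuousOnInterval_iff] at hf ⊢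
  intro ε hε
  obtain ⟨δ, hδ, h⟩ := hf ε hε
  refine ⟨δ, hδ, fun E hE hE' => lt_of_eq_of_lt (Finset.sum_congr rfl fun i hi => ?_) (h E hE hE')⟩
  rw [hfg (hE.1 i hi).1, hfg (hE.1 i hi).2]

theorem lipschitzOnWith_comp {f g : ℝ → ℝ} {a b : ℝ} {s : Set ℝ} {K : NNReal}
    (hf : AbsolutelyContinuousOnInterval f a b) (hg : LipschitzOnWith K g s)
    (hfs : MapsTo f (uIcc a b) s) : AbsolutelyContinuousOnInterval (fun x => g (f x)) a b := by
  rw [absolutelyContinuousOnInterval_iff] at hf ⊢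
  intro ε hε
  obtain ⟨δ, hδ, h⟩ := hf (ε / (K + 1)) (by positivity)
  refine ⟨δ, hδ, fun E hE hE' => ?_⟩
  have h1 := h E hE hE'
  rw [lt_div_iff₀ (by positivity), mul_comm] at h1
  refine lt_of_le_of_lt ?_ h1
  rw [Finset.mul_sum]
  refine Finset.sum_le_sum fun i hi => ?_
  refine (hg.dist_le_mul _ (hfs (hE.1 i hi).1) _ (hfs (hE.1 i hi).2)).trans ?_
  gcongr
  linarith

theorem contDiffOn_comp {f g : ℝ → ℝ} {a b c d : ℝ}
    (hf : AbsolutelyContinuousOnInterval f a b) (hg : ContDiffOn ℝ 1 g (Icc c d))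
    (hfs : MapsTo f (uIcc a b) (Icc c d)) :
    AbsolutelyContinuousOnInterval (fun x => g (f x)) a b := by
  obtain ⟨K, hK⟩ := hg.exists_lipschitzOnWith (by decide) (convex_Icc _ _) isCompact_Icc
  exact hf.lipschitzOnWith_comp hK hfs

theorem inv_of_pos {f : ℝ → ℝ} {a b : ℝ}
    (hf : AbsolutelyContinuousOnInterval f a b) (hpos : ∀ x ∈ uIcc a b, 0 < f x) :
    AbsolutelyContinuousOnInterval (fun x => (f x)⁻¹) a b := by
  obtain ⟨x₀, hx₀, hmin⟩ := isCompact_uIcc.exists_isMinOn nonempty_uIcc hf.continuousOn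
  obtain ⟨x₁, -, hmax⟩ := isCompact_uIcc.exists_isMaxOn nonempty_uIcc hf.continuousOn
  refine hf.contDiffOn_comp (g := fun y => y⁻¹) (c := f x₀) (d := f x₁) ?_
    fun x hx => ⟨hmin hx, hmax hx⟩
  exact contDiffOn_id.inv fun y hy => ((hpos x₀ hx₀).trans_le hy.1).ne'

theorem monotoneOn_of_ae_hasDerivAt_nonneg {f f' : ℝ → ℝ} {a b : ℝ} (hab : a ≤ b)
    (hf : AbsolutelyContinuousOnInterval f a b)
    (hf' : ∀ᵐ x ∂(volume.restrict (Icc a b)), HasDerivAt f (f' x) x ∧ 0 ≤ f' x) :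
    MonotoneOn f (Icc a b) := by
  intro x hx y hy hxy
  have hsub : Icc x y ⊆ Icc a b := Icc_subset_Icc hx.1 hy.2
  have h1 := (hf.mono (c := x) (d := y)
    (by rwa [uIcc_of_le hxy, uIcc_of_le hab])).integral_deriv_eq_sub
  have h2 : 0 ≤ ∫ t in x..y, deriv f t := by
    refine intervalIntegral.integral_nonneg_of_ae_restrict hxy ?_
    filter_upwards [ae_restrict_of_ae_restrict_of_subset hsub hf'] with t ht
    rw [ht.1.deriv]
    exact ht.2
  linarith

end AbsolutelyContinuousOnInterval

/-! ### Existence for the boundary value problem -/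

theorem contDiffOn_one_Icc {F G : ℝ → ℝ}
    (hF : ∀ x ∈ Icc (0 : ℝ) 1, HasDerivWithinAt F (G x) (Icc 0 1) x)
    (hG : ContinuousOn G (Icc 0 1)) : ContDiffOn ℝ 1 F (Icc 0 1) := by
  have hu : UniqueDiffOn ℝ (Icc (0 : ℝ) 1) := uniqueDiffOn_Icc zero_lt_one
  rw [show (1 : WithTop ℕ∞) = 0 + 1 by simp, contDiffOn_succ_iff_derivWithin hu]
  refine ⟨fun x hx => (hF x hx).differentiableWithinAt, by simp, contDiffOn_zero.2 ?_⟩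
  exact hG.congr fun x hx => (hF x hx).derivWithin (hu x hx)

theorem derivUnit_eq {F : ℝ → ℝ} {g x : ℝ} (hx : x ∈ Icc (0 : ℝ) 1)
    (hF : HasDerivWithinAt F g (Icc 0 1) x) : derivUnit F x = g :=
  hF.derivWithin (uniqueDiffOn_Icc zero_lt_one x hx)

theorem derivUnit_congr {F G : ℝ → ℝ} (h : EqOn F G (Icc 0 1)) {x : ℝ} (hx : x ∈ Icc (0 : ℝ) 1) :
    derivUnit F x = derivUnit G x :=
  derivWithin_congr h (h hx)

/-- Almost every point of `[0,1]` is an interior point. -/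
theorem ae_mem_Ioo : ∀ᵐ x ∂(volume.restrict (Icc (0 : ℝ) 1)), x ∈ Ioo (0 : ℝ) 1 := by
  rw [← restrict_Ioo_eq_restrict_Icc]
  exact ae_restrict_mem measurableSet_Ioo

theorem profiles_intervalIntegrable {m : ℝ → ℝ} (hm : m ∈ profiles) :
    IntervalIntegrable m volume 0 1 := by
  rw [intervalIntegrable_iff_integrableOn_Icc_of_le zero_le_one]
  refine Measure.integrableOn_of_bounded (M := 1) (by simp) hm.1.aestronglyMeasurable ?_
  filter_upwards [ae_restrict_mem measurableSet_Icc] with x hx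
  rw [Real.norm_eq_abs, abs_of_nonneg (hm.2 x hx).1]
  exact (hm.2 x hx).2

/-- `F = sigmoid p` with `p' = 1 / w`, `w = v + M`, where `M` is a primitive of `1 - m` and
`v' = -F`. -/
theorem exists_isBVPSolution {α β : ℝ} (hα : 0 < α) (hαβ : α < β) (hβ : β < 1) {m : ℝ → ℝ}
    (hm : m ∈ profiles) : ∃ F, IsBVPSolution α β m F := by
  have hmi := profiles_intervalIntegrable hm
  have hi : IntervalIntegrable (fun t => 1 - m t) volume 0 1 :=
    intervalIntegrable_const.sub hmi
  set M : ℝ → ℝ := fun x => ∫ t in (0 : ℝ)..x, (1 - m t) with hMdef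
  have hMsub : ∀ x ∈ Icc (0 : ℝ) 1, ∀ y ∈ Icc (0 : ℝ) 1, x ≤ y →
      0 ≤ M y - M x ∧ M y - M x ≤ y - x := by
    intro x hx y hy hxy
    have hsub : ∀ s ∈ Icc (0 : ℝ) 1, ∀ t ∈ Icc (0 : ℝ) 1,
        IntervalIntegrable (fun t => 1 - m t) volume s t := fun s hs t ht =>
      hi.mono_set (by rw [uIcc_of_le zero_le_one]; exact uIcc_subset_Icc hs ht)
    have e : M y - M x = ∫ t in x..y, (1 - m t) :=
      intervalIntegral.integral_interval_sub_left (hsub 0 (by simp) y hy) (hsub 0 (by simp) x hx)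
    rw [e]
    have hb : ∀ t ∈ Icc x y, m t ∈ Icc (0 : ℝ) 1 := fun t ht =>
      hm.2 t ⟨hx.1.trans ht.1, ht.2.trans hy.2⟩
    constructor
    · exact intervalIntegral.integral_nonneg hxy fun t ht => by linarith [(hb t ht).2]
    · have := intervalIntegral.integral_mono_on hxy (hsub x hx y hy)
        (intervalIntegrable_const (c := (1 : ℝ))) fun t ht => by linarith [(hb t ht).1]
      simpa using this
  have hlogit : ∀ y ∈ Ioo (0 : ℝ) 1, ∃ z, Real.sigmoid z = y := fun y hy => by
    rwa [← Real.range_sigmoid] at hy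
  obtain ⟨a, ha⟩ := hlogit α ⟨hα, hαβ.trans hβ⟩
  obtain ⟨b, hb⟩ := hlogit β ⟨hα.trans hαβ, hβ⟩
  have hab : a < b := by rwa [← Real.sigmoid_lt_iff, ha, hb]
  obtain ⟨p, v, hp0, hp1, hpv⟩ := exists_shooting_solution (M := M) (by simp [hMdef]) hMsub hab
  set F : ℝ → ℝ := fun x => Real.sigmoid (p x) with hFdef
  set w : ℝ → ℝ := fun x => v x + M x with hwdef
  set G : ℝ → ℝ := fun x => F x * (1 - F x) * (w x)⁻¹ with hGdef
  have hF0 : ∀ x, 0 < F x := fun x => Real.sigmoid_pos _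
  have hF1 : ∀ x, 0 < 1 - F x := fun x => sub_pos.2 (Real.sigmoid_lt_one _)
  have hu : uIcc (0 : ℝ) 1 = Icc 0 1 := uIcc_of_le zero_le_one
  have hFd : ∀ x ∈ Icc (0 : ℝ) 1, HasDerivWithinAt F (G x) (Icc 0 1) x := by
    intro x hx
    have := (Real.hasDerivAt_sigmoid (p x)).comp_hasDerivWithinAt x (hpv x hx).2.1
    rw [one_div] at this
    exact this
  have hFc : ContinuousOn F (Icc 0 1) := fun x hx => (hFd x hx).continuousWithinAt
  have hvac : AbsolutelyContinuousOnInterval v 0 1 := by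
    refine ContDiffOn.absolutelyContinuousOnInterval ?_
    rw [hu]
    exact contDiffOn_one_Icc (fun x hx => (hpv x hx).2.2) hFc.neg
  have hMac : AbsolutelyContinuousOnInterval M 0 1 :=
    hi.absolutelyContinuousOnInterval_intervalIntegral (by simp)
  have hwac : AbsolutelyContinuousOnInterval w 0 1 := hvac.fun_add hMac
  have hwinv : AbsolutelyContinuousOnInterval (fun x => (w x)⁻¹) 0 1 :=
    hwac.inv_of_pos fun x hx => (hpv x (hu ▸ hx)).1
  have hGc : ContinuousOn G (Icc 0 1) :=
    (hFc.mul (continuousOn_const.sub hFc)).mul (hu ▸ hwinv.continuousOn)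
  have hFcd : ContDiffOn ℝ 1 F (Icc 0 1) := contDiffOn_one_Icc hFd hGc
  have hFFac : AbsolutelyContinuousOnInterval (fun x => F x * (1 - F x)) 0 1 :=
    ContDiffOn.absolutelyContinuousOnInterval
      (by rw [hu]; exact hFcd.mul (contDiffOn_const.sub hFcd))
  have hdG : EqOn G (derivUnit F) (Icc 0 1) := fun x hx => (derivUnit_eq hx (hFd x hx)).symm
  refine ⟨F, hFcd, ?_, (hFFac.fun_mul hwinv).congr_uIcc (hu ▸ hdG), ?_, ?_, ?_⟩
  · refine monotoneOn_Icc_of_hasDerivWithinAt hFd fun x hx => ?_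
    have := (hpv x hx).1
    have := hF0 x
    have := hF1 x
    positivity
  · have hae := hi.ae_hasDerivAt_integral
    filter_upwards [ae_restrict_of_ae hae, ae_mem_Ioo] with x hx hxI
    have hxc := Ioo_subset_Icc_self hxI
    have hnhds : Icc (0 : ℝ) 1 ∈ 𝓝 x := Icc_mem_nhds hxI.1 hxI.2
    have hMd : HasDerivAt M (1 - m x) x := hx (by rwa [hu]) 0 (by simp)
    have hFd' := (hFd x hxc).hasDerivAt hnhds
    have hwd : HasDerivAt w (-F x + (1 - m x)) x := ((hpv x hxc).2.2.hasDerivAt hnhds).add hMd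
    have hwx : w x ≠ 0 := (hpv x hxc).1.ne'
    have hGd := (hFd'.mul (hFd'.const_sub 1)).mul (hwd.inv hwx)
    have heq : derivUnit F =ᶠ[𝓝 x] G := by
      filter_upwards [hnhds] with y hy using (hdG hy).symm
    rw [← hdG hxc]
    refine HasDerivAt.congr_of_eventuallyEq ?_ heq
    refine HasDerivAt.congr_deriv hGd ?_
    simp only [Pi.mul_apply, Pi.inv_apply, hGdef]
    have e0 := (hF0 x).ne'
    have e1 := (hF1 x).ne'
    field_simp
    ring
  · simp only [hFdef, hp0, ha]
  · simp only [hFdef, hp1, hb]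

/-! ### Uniqueness for the boundary value problem -/

namespace IsBVPSolution

variable {α β : ℝ} {m F : ℝ → ℝ}

theorem hasDerivWithinAt (h : IsBVPSolution α β m F) {x : ℝ} (hx : x ∈ Icc (0 : ℝ) 1) :
    HasDerivWithinAt F (derivUnit F x) (Icc 0 1) x :=
  (h.contDiffOn.differentiableOn (by decide) x hx).hasDerivWithinAt

theorem continuousOn_derivUnit (h : IsBVPSolution α β m F) :
    ContinuousOn (derivUnit F) (Icc 0 1) := by
  simpa using h.deriv_ac.continuousOn

theorem mem_Icc (h : IsBVPSolution α β m F) {x : ℝ} (hx : x ∈ Icc (0 : ℝ) 1) :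
    F x ∈ Icc α β := by
  rw [← h.left_bdry, ← h.right_bdry]
  exact ⟨h.monotoneOn (by simp) hx hx.1, h.monotoneOn hx (by simp) hx.2⟩

theorem derivUnit_nonneg (h : IsBVPSolution α β m F) (x : ℝ) : 0 ≤ derivUnit F x :=
  h.monotoneOn.derivWithin_nonneg

theorem ae_hasDerivAt (h : IsBVPSolution α β m F) :
    ∀ᵐ x ∂(volume.restrict (Icc (0 : ℝ) 1)), x ∈ Ioo (0 : ℝ) 1 ∧ HasDerivAt F (derivUnit F x) x ∧
      HasDerivAt (derivUnit F)
        ((m x - F x) * (derivUnit F x) ^ 2 / (F x * (1 - F x))) x := by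
  filter_upwards [h.equation, ae_mem_Ioo] with x hx hxI
  exact ⟨hxI, (h.hasDerivWithinAt (Ioo_subset_Icc_self hxI)).hasDerivAt
    (Icc_mem_nhds hxI.1 hxI.2), hx⟩

/-- `F' / (1 - F)²` is increasing and `F' / F²` is decreasing, so that a zero of `F'` would force
`F' = 0` throughout. -/
theorem derivUnit_pos (h : IsBVPSolution α β m F) (hm : m ∈ profiles) (hα : 0 < α) (hαβ : α < β)
    (hβ : β < 1) {x : ℝ} (hx : x ∈ Icc (0 : ℝ) 1) : 0 < derivUnit F x := by
  have hu : uIcc (0 : ℝ) 1 = Icc 0 1 := uIcc_of_le zero_le_one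
  have hF0 : ∀ y ∈ Icc (0 : ℝ) 1, 0 < F y := fun y hy => hα.trans_le (h.mem_Icc hy).1
  have hF1 : ∀ y ∈ Icc (0 : ℝ) 1, 0 < 1 - F y := fun y hy => by linarith [(h.mem_Icc hy).2]
  have hmono : MonotoneOn (fun y => derivUnit F y * ((1 - F y) ^ 2)⁻¹) (Icc 0 1) := by
    refine AbsolutelyContinuousOnInterval.monotoneOn_of_ae_hasDerivAt_nonneg zero_le_one
      (f' := fun x => (m x + F x) * (derivUnit F x) ^ 2 / (F x * (1 - F x) ^ 3))
      (h.deriv_ac.fun_mul (ContDiffOn.absolutelyContinuousOnInterval ?_)) ?_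
    · rw [hu]
      exact ((contDiffOn_const.sub h.contDiffOn).pow 2).inv
        fun y hy => (pow_pos (hF1 y hy) 2).ne'
    · filter_upwards [h.ae_hasDerivAt] with y ⟨hyI, hy1, hy2⟩
      have hyc := Ioo_subset_Icc_self hyI
      have e0 := hF0 y hyc
      have e1 := hF1 y hyc
      constructor
      · refine HasDerivAt.congr_deriv (hy2.mul (((hy1.const_sub 1).pow 2).inv (pow_pos e1 2).ne')) ?_
        simp only [Pi.pow_apply]
        field_simp
        ring
      · have := (hm.2 y hyc).1
        positivity
  have hanti : MonotoneOn (fun y => -derivUnit F y * ((F y) ^ 2)⁻¹) (Icc 0 1) := by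
    refine AbsolutelyContinuousOnInterval.monotoneOn_of_ae_hasDerivAt_nonneg zero_le_one
      (f' := fun x => ((1 - m x) + (1 - F x)) * (derivUnit F x) ^ 2 / (F x ^ 3 * (1 - F x)))
      (h.deriv_ac.fun_neg.fun_mul (ContDiffOn.absolutelyContinuousOnInterval ?_)) ?_
    · rw [hu]
      exact (h.contDiffOn.pow 2).inv fun y hy => (pow_pos (hF0 y hy) 2).ne'
    · filter_upwards [h.ae_hasDerivAt] with y ⟨hyI, hy1, hy2⟩
      have hyc := Ioo_subset_Icc_self hyI
      have e0 := hF0 y hyc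
      have e1 := hF1 y hyc
      constructor
      · refine HasDerivAt.congr_deriv (hy2.neg.mul ((hy1.pow 2).inv (pow_pos e0 2).ne')) ?_
        simp only [Pi.pow_apply, Pi.neg_apply]
        field_simp
        ring
      · have : 0 ≤ 1 - m y := by linarith [(hm.2 y hyc).2]
        positivity
  by_contra hcon
  have hx0 : derivUnit F x = 0 := le_antisymm (not_lt.1 hcon) (h.derivUnit_nonneg x)
  have hzero : ∀ y ∈ Icc (0 : ℝ) 1, derivUnit F y = 0 := by
    intro y hy
    refine le_antisymm ?_ (h.derivUnit_nonneg y)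
    rcases le_total y x with hyx | hyx
    · have := hmono hy hx hyx
      simp only [hx0, zero_mul] at this
      exact nonpos_of_mul_nonpos_left this (inv_pos.2 (pow_pos (hF1 y hy) 2))
    · have := hanti hx hy hyx
      simp only [hx0, neg_zero, zero_mul, neg_mul] at this
      exact nonpos_of_mul_nonpos_left (neg_nonneg.1 this) (inv_pos.2 (pow_pos (hF0 y hy) 2))
  have := constant_of_derivWithin_zero (h.contDiffOn.differentiableOn (by decide))
    (fun y hy => hzero y (Ico_subset_Icc_self hy)) 1 (by simp)
  rw [h.left_bdry, h.right_bdry] at this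
  exact hαβ.ne' this

/-- In the variables `φ = log (F / (1 - F))` and `w = F (1 - F) / F'` the equation becomes
`φ' = 1 / w`, `w' = 1 - m - F`. For two solutions, `(w₁ - w₂) (φ₁ - φ₂)` is therefore decreasing;
it vanishes at both end points. -/
theorem eqOn (h₁ : IsBVPSolution α β m F) {G : ℝ → ℝ} (h₂ : IsBVPSolution α β m G)
    (hm : m ∈ profiles) (hα : 0 < α) (hαβ : α < β) (hβ : β < 1) : EqOn F G (Icc 0 1) := by
  have hu : uIcc (0 : ℝ) 1 = Icc 0 1 := uIcc_of_le zero_le_one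
  set l : ℝ → ℝ := fun y => Real.log y - Real.log (1 - y) with hl
  have hlmono : StrictMonoOn l (Ioo 0 1) := by
    intro s hs t ht hst
    have e1 := Real.log_lt_log hs.1 hst
    have e2 := Real.log_lt_log (sub_pos.2 ht.2) (sub_lt_sub_left hst 1)
    simp only [hl]
    linarith
  have hmem : ∀ {H : ℝ → ℝ}, IsBVPSolution α β m H → ∀ y ∈ Icc (0 : ℝ) 1, H y ∈ Ioo (0 : ℝ) 1 :=
    fun h y hy => ⟨hα.trans_le (h.mem_Icc hy).1, (h.mem_Icc hy).2.trans_lt hβ⟩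
  let w : (ℝ → ℝ) → ℝ → ℝ := fun H x => H x * (1 - H x) * (derivUnit H x)⁻¹
  have hwac : ∀ {H : ℝ → ℝ}, IsBVPSolution α β m H →
      AbsolutelyContinuousOnInterval (w H) 0 1 := fun {H} h => by
    refine AbsolutelyContinuousOnInterval.fun_mul (ContDiffOn.absolutelyContinuousOnInterval ?_)
      (h.deriv_ac.inv_of_pos fun x hx => h.derivUnit_pos hm hα hαβ hβ (hu ▸ hx))
    rw [hu]
    exact h.contDiffOn.mul (contDiffOn_const.sub h.contDiffOn)
  have hlac : ∀ {H : ℝ → ℝ}, IsBVPSolution α β m H →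
      AbsolutelyContinuousOnInterval (fun x => l (H x)) 0 1 := fun {H} h => by
    refine ContDiffOn.absolutelyContinuousOnInterval ?_
    rw [hu]
    exact (h.contDiffOn.log fun x hx => (hmem h x hx).1.ne').sub
      ((contDiffOn_const.sub h.contDiffOn).log fun x hx => (sub_pos.2 (hmem h x hx).2).ne')
  have hwpos : ∀ {H : ℝ → ℝ}, IsBVPSolution α β m H → ∀ x ∈ Icc (0 : ℝ) 1, 0 < w H x :=
    fun h x hx => mul_pos (mul_pos (hmem h x hx).1 (sub_pos.2 (hmem h x hx).2))
      (inv_pos.2 (h.derivUnit_pos hm hα hαβ hβ hx))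
  have hder : ∀ {H : ℝ → ℝ}, IsBVPSolution α β m H → ∀ᵐ x ∂(volume.restrict (Icc (0 : ℝ) 1)),
      HasDerivAt (w H) (1 - m x - H x) x ∧ HasDerivAt (fun x => l (H x)) (1 / w H x) x := by
    intro H h
    filter_upwards [h.ae_hasDerivAt] with x ⟨hxI, hx1, hx2⟩
    have hxc := Ioo_subset_Icc_self hxI
    have e0 := (hmem h x hxc).1.ne'
    have e1 := (sub_pos.2 (hmem h x hxc).2).ne'
    have e2 := (h.derivUnit_pos hm hα hαβ hβ hxc).ne'
    constructor
    · refine HasDerivAt.congr_deriv ((hx1.mul (hx1.const_sub 1)).mul (hx2.inv e2)) ?_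
      simp only [Pi.mul_apply]
      field_simp
      ring
    · refine HasDerivAt.congr_deriv ((hx1.log e0).sub ((hx1.const_sub 1).log e1)) ?_
      simp only [w]
      field_simp
      ring
  set P : ℝ → ℝ := fun x => -((w F x - w G x) * (l (F x) - l (G x))) with hP
  set P' : ℝ → ℝ := fun x => (F x - G x) * (l (F x) - l (G x)) +
    (w F x - w G x) * (1 / w G x - 1 / w F x) with hP'
  have hnn : ∀ x ∈ Icc (0 : ℝ) 1, 0 ≤ (F x - G x) * (l (F x) - l (G x)) ∧
      0 ≤ (w F x - w G x) * (1 / w G x - 1 / w F x) := by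
    intro x hx
    constructor
    · rcases le_total (F x) (G x) with hfg | hfg
      · exact mul_nonneg_of_nonpos_of_nonpos (sub_nonpos.2 hfg)
          (sub_nonpos.2 (hlmono.monotoneOn (hmem h₁ x hx) (hmem h₂ x hx) hfg))
      · exact mul_nonneg (sub_nonneg.2 hfg)
          (sub_nonneg.2 (hlmono.monotoneOn (hmem h₂ x hx) (hmem h₁ x hx) hfg))
    · have e1 := hwpos h₁ x hx
      have e2 := hwpos h₂ x hx
      have : (w F x - w G x) * (1 / w G x - 1 / w F x) =
          (w F x - w G x) ^ 2 / (w G x * w F x) := by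
        field_simp
      rw [this]
      positivity
  have hPd : ∀ᵐ x ∂(volume.restrict (Icc (0 : ℝ) 1)), HasDerivAt P (P' x) x := by
    filter_upwards [hder h₁, hder h₂] with x hx1 hx2
    refine HasDerivAt.congr_deriv (((hx1.1.sub hx2.1).mul (hx1.2.sub hx2.2)).neg) ?_
    simp only [hP', Pi.sub_apply]
    ring
  have hPac : AbsolutelyContinuousOnInterval P 0 1 :=
    (((hwac h₁).fun_sub (hwac h₂)).fun_mul ((hlac h₁).fun_sub (hlac h₂))).fun_neg
  have hPmono : MonotoneOn P (Icc 0 1) := by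
    refine hPac.monotoneOn_of_ae_hasDerivAt_nonneg zero_le_one (f' := P') ?_
    filter_upwards [hPd, ae_restrict_mem measurableSet_Icc] with x hx hxc
    exact ⟨hx, add_nonneg (hnn x hxc).1 (hnn x hxc).2⟩
  have hP0 : ∀ x ∈ Icc (0 : ℝ) 1, P x = 0 := by
    intro x hx
    have e1 := hPmono (by simp) hx hx.1
    have e2 := hPmono hx (by simp) hx.2
    have z0 : P 0 = 0 := by simp [hP, h₁.left_bdry, h₂.left_bdry]
    have z1 : P 1 = 0 := by simp [hP, h₁.right_bdry, h₂.right_bdry]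
    linarith
  refine Measure.eqOn_Icc_of_ae_eq volume zero_ne_one ?_ h₁.contDiffOn.continuousOn
    h₂.contDiffOn.continuousOn
  filter_upwards [hPd, ae_mem_Ioo] with x hx hxI
  have hxc := Ioo_subset_Icc_self hxI
  have heq : P =ᶠ[𝓝 x] fun _ => 0 := by
    filter_upwards [Icc_mem_nhds hxI.1 hxI.2] with y hy using hP0 y hy
  have hz : P' x = 0 := (hx.congr_of_eventuallyEq heq.symm).unique (hasDerivAt_const x 0)
  -- both summands of `P' x = 0` are nonnegative
  have hprod : (F x - G x) * (l (F x) - l (G x)) = 0 := by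
    have := hnn x hxc
    simp only [hP'] at hz
    linarith
  rcases mul_eq_zero.1 hprod with hh | hh
  · exact sub_eq_zero.1 hh
  · exact hlmono.injOn (hmem h₁ x hxc) (hmem h₂ x hxc) (sub_eq_zero.1 hh)

end IsBVPSolution

/-! ### The weighted logarithm and the entropy -/

theorem weighted_log_gap_nonneg {θ y : ℝ} (hθ : θ ∈ Icc (0 : ℝ) 1) (hy : y ∈ Ioo (0 : ℝ) 1) :
    0 ≤ θ * Real.log y + (1 - θ) * Real.log (1 - y) - Real.log (min y (1 - y)) := by
  have hm : 0 < min y (1 - y) := lt_min hy.1 (sub_pos.2 hy.2)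
  have h1 := Real.log_le_log hm (min_le_left y (1 - y))
  have h2 := Real.log_le_log hm (min_le_right y (1 - y))
  have e1 := mul_le_mul_of_nonneg_left h1 hθ.1
  have e2 := mul_le_mul_of_nonneg_left h2 (sub_nonneg.2 hθ.2)
  linarith

theorem weighted_log_gap_eq_zero {θ y : ℝ} (hy : y ∈ Ioo (0 : ℝ) 1)
    (h : θ * Real.log y + (1 - θ) * Real.log (1 - y) - Real.log (min y (1 - y)) = 0) :
    (y < 1 / 2 → θ = 1) ∧ (1 / 2 < y → θ = 0) := by
  constructor <;> intro hlt
  · rw [min_eq_left (by linarith)] at h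
    have hlog := Real.log_lt_log hy.1 (show y < 1 - y by linarith)
    have hprod : (1 - θ) * (Real.log (1 - y) - Real.log y) = 0 := by linarith
    rcases mul_eq_zero.1 hprod with h0 | h0 <;> linarith
  · rw [min_eq_right (by linarith)] at h
    have hlog := Real.log_lt_log (sub_pos.2 hy.2) (show 1 - y < y by linarith)
    have hprod : θ * (Real.log y - Real.log (1 - y)) = 0 := by linarith
    rcases mul_eq_zero.1 hprod with h0 | h0 <;> linarith

theorem continuous_entropyDensity : Continuous entropyDensity :=
  Real.continuous_mul_log.add (Real.continuous_mul_log.comp (continuous_const.sub continuous_id))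

theorem entropyDensity_comp_intervalIntegrable {m : ℝ → ℝ} (hm : m ∈ profiles) :
    IntervalIntegrable (fun x => entropyDensity (m x)) volume 0 1 := by
  obtain ⟨C, hC⟩ := isCompact_Icc.exists_bound_of_continuousOn (s := Icc (0 : ℝ) 1)
    continuous_entropyDensity.continuousOn
  rw [intervalIntegrable_iff_integrableOn_Icc_of_le zero_le_one]
  refine Measure.integrableOn_of_bounded (M := C) (by simp)
    (continuous_entropyDensity.measurable.comp hm.1).aestronglyMeasurable ?_
  filter_upwards [ae_restrict_mem measurableSet_Icc] with x hx using hC _ (hm.2 x hx)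

theorem weighted_log_intervalIntegrable {m F : ℝ → ℝ} (hm : m ∈ profiles)
    (hF : ContinuousOn F (Icc 0 1)) (hF01 : ∀ x ∈ Icc (0 : ℝ) 1, F x ∈ Ioo (0 : ℝ) 1) :
    IntervalIntegrable
      (fun x => m x * Real.log (F x) + (1 - m x) * Real.log (1 - F x)) volume 0 1 := by
  have hu : uIcc (0 : ℝ) 1 = Icc 0 1 := uIcc_of_le zero_le_one
  have hmi := profiles_intervalIntegrable hm
  refine (hmi.mul_continuousOn ?_).add ((intervalIntegrable_const.sub hmi).mul_continuousOn ?_)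
  · rw [hu]; exact hF.log fun x hx => (hF01 x hx).1.ne'
  · rw [hu]; exact (continuousOn_const.sub hF).log fun x hx => (sub_pos.2 (hF01 x hx).2).ne'

/-- Adding the entropy cancels the terms `m log m` and `(1 - m) log (1 - m)` of the relative
entropy. -/
theorem integral_add_profileEntropy {m F q : ℝ → ℝ} (hm : m ∈ profiles)
    (hF : ContinuousOn F (Icc 0 1)) (hF01 : ∀ x ∈ Icc (0 : ℝ) 1, F x ∈ Ioo (0 : ℝ) 1)
    (hq : IntervalIntegrable q volume 0 1) :
    (∫ x in (0 : ℝ)..1, (m x * Real.log (m x / F x) +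
      (1 - m x) * Real.log ((1 - m x) / (1 - F x)) + q x)) + profileEntropy m =
    ∫ x in (0 : ℝ)..1,
      (q x - (m x * Real.log (F x) + (1 - m x) * Real.log (1 - F x))) := by
  have hu : uIcc (0 : ℝ) 1 = Icc 0 1 := uIcc_of_le zero_le_one
  have hw := weighted_log_intervalIntegrable hm hF hF01
  have key : ∀ {s y : ℝ}, 0 < y → s * Real.log (s / y) = s * Real.log s - s * Real.log y := by
    intro s y hy
    rcases eq_or_ne s 0 with rfl | hs
    · simp
    · rw [Real.log_div hs hy.ne']; ring
  have : ∀ x ∈ uIcc (0 : ℝ) 1, m x * Real.log (m x / F x) +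
      (1 - m x) * Real.log ((1 - m x) / (1 - F x)) + q x = entropyDensity (m x) +
      (q x - (m x * Real.log (F x) + (1 - m x) * Real.log (1 - F x))) := by
    intro x hx
    rw [hu] at hx
    rw [key (hF01 x hx).1, key (sub_pos.2 (hF01 x hx).2), entropyDensity]
    ring
  rw [intervalIntegral.integral_congr this, intervalIntegral.integral_add
    (entropyDensity_comp_intervalIntegrable hm) (hq.sub hw), profileEntropy]
  ring

theorem integral_eq_zero_iff_ae_Icc {D : ℝ → ℝ} (hi : IntervalIntegrable D volume 0 1)
    (hD : ∀ x ∈ Icc (0 : ℝ) 1, 0 ≤ D x) :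
    ∫ x in (0 : ℝ)..1, D x = 0 ↔ ∀ᵐ x ∂(volume.restrict (Icc (0 : ℝ) 1)), D x = 0 := by
  rw [intervalIntegral.integral_of_le zero_le_one, ← integral_Icc_eq_integral_Ioc,
    setIntegral_eq_zero_iff_of_nonneg_ae]
  · rfl
  · filter_upwards [ae_restrict_mem measurableSet_Icc] with x hx using hD x hx
  · exact (intervalIntegrable_iff_integrableOn_Icc_of_le zero_le_one).1 hi

/-! ### The extremal curve -/

/-- `min y (1 - y)`, cut off from below at the level `c`. -/
noncomputable def truncMin (c y : ℝ) : ℝ := max c (min y (1 - y))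

theorem lipschitzWith_truncMin (c : ℝ) : LipschitzWith 1 (truncMin c) := by
  have h := (LipschitzWith.id (α := ℝ)).min (g := fun y : ℝ => 1 - y) (Kg := 1)
    (LipschitzWith.of_dist_le_mul fun x y => by
      rw [Real.dist_eq, Real.dist_eq, NNReal.coe_one, one_mul, sub_sub_sub_cancel_left,
        abs_sub_comm])
  rw [max_self] at h
  exact h.const_max c

theorem truncMin_pos {c : ℝ} (hc : 0 < c) (y : ℝ) : 0 < truncMin c y := lt_max_of_lt_left hc

theorem truncMin_eq {α β y : ℝ} (hy : y ∈ Icc α β) :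
    truncMin (min α (1 - β)) y = min y (1 - y) :=
  max_eq_right (min_le_min hy.1 (by linarith [hy.2]))

theorem truncMin_le {c : ℝ} (hc : c ≤ 1 / 2) (y : ℝ) : truncMin c y ≤ 1 / 2 := by
  refine max_le hc ?_
  rcases le_total y (1 / 2) with h | h
  · exact (min_le_left _ _).trans h
  · exact (min_le_right _ _).trans (by linarith)

/-- A primitive of `1 / truncMin c`. -/
noncomputable def truncPotential (c a y : ℝ) : ℝ := ∫ t in a..y, 1 / truncMin c t

theorem hasDerivAt_truncPotential {c : ℝ} (hc : 0 < c) (a y : ℝ) :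
    HasDerivAt (truncPotential c a) (1 / truncMin c y) y := by
  have hcont : Continuous fun t => 1 / truncMin c t :=
    continuous_const.div (lipschitzWith_truncMin c).continuous fun t => (truncMin_pos hc t).ne'
  exact hcont.integral_hasStrictDerivAt a y |>.hasDerivAt

theorem truncPotential_right {α β : ℝ} (hαβ : α ≤ β) :
    truncPotential (min α (1 - β)) α β = ∫ x in α..β, 1 / min x (1 - x) := by
  refine intervalIntegral.integral_congr fun x hx => ?_
  rw [uIcc_of_le hαβ] at hx
  simp only [truncMin_eq hx]

theorem integral_inv_min_pos {α β : ℝ} (hα : 0 < α) (hαβ : α < β) (hβ : β < 1) :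
    0 < ∫ x in α..β, 1 / min x (1 - x) := by
  have hpos : ∀ x ∈ Icc α β, 0 < min x (1 - x) := fun x hx =>
    lt_min (hα.trans_le hx.1) (by linarith [hx.2])
  refine intervalIntegral.intervalIntegral_pos_of_pos_on ?_ (fun x hx => ?_) hαβ
  · refine ContinuousOn.intervalIntegrable ?_
    rw [uIcc_of_le hαβ.le]
    exact continuousOn_const.div (by fun_prop) fun x hx => (hpos x hx).ne'
  · exact one_div_pos.2 (hpos x (Ioo_subset_Icc_self hx))

/-- The extremal curve: the solution of `F' = K min (F, 1 - F)` from `α` to `β`, obtained as the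
inverse function of a primitive of `1 / min (y, 1 - y)`. -/
theorem exists_extremal {α β : ℝ} (hα : 0 < α) (hαβ : α < β) (hβ : β < 1) :
    ∃ F : ℝ → ℝ, StrictMono F ∧ F 0 = α ∧ F 1 = β ∧ ∀ x, HasDerivAt F
      ((∫ x in α..β, 1 / min x (1 - x)) * truncMin (min α (1 - β)) (F x)) x := by
  set c := min α (1 - β) with hc
  set K := ∫ x in α..β, 1 / min x (1 - x) with hK
  have hKpos : 0 < K := integral_inv_min_pos hα hαβ hβ
  have hcpos : 0 < c := lt_min hα (sub_pos.2 hβ)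
  have hc2 : c ≤ 1 / 2 := by
    have h1 := min_le_left α (1 - β)
    have h2 := min_le_right α (1 - β)
    linarith
  set L := truncPotential c α with hL
  have hLd : ∀ y, HasDerivAt L (1 / truncMin c y) y := hasDerivAt_truncPotential hcpos α
  have hLmono : StrictMono L := strictMono_of_hasDerivAt_pos hLd
    fun y => one_div_pos.2 (truncMin_pos hcpos y)
  have hLα : L α = 0 := by simp [hL, truncPotential]
  have hLβ : L β = K := truncPotential_right hαβ.le
  have hgrow : Monotone fun y => L y - 2 * y := by
    refine monotone_of_hasDerivAt_nonneg
      (fun y => (hLd y).sub ((hasDerivAt_id y).const_mul 2)) fun y => ?_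
    have := one_div_le_one_div_of_le (truncMin_pos hcpos y) (truncMin_le hc2 y)
    rw [one_div_one_div] at this
    simp only [Pi.zero_apply]
    linarith
  have hLcont : Continuous L := continuous_iff_continuousAt.2 fun y => (hLd y).continuousAt
  have hsurj : Function.Surjective L := by
    refine hLcont.surjective ?_ ?_
    · refine tendsto_atTop_mono' atTop (f₁ := fun y => 2 * y - 2 * α) ?_ ?_
      · filter_upwards [eventually_ge_atTop α] with y hy
        have := hgrow hy
        simp only [hLα] at this
        linarith
      · exact tendsto_atTop_add_const_right _ _ (tendsto_id.const_mul_atTop two_pos)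
    · refine tendsto_atBot_mono' atBot (f₁ := fun y => 2 * y - 2 * α) ?_ ?_
      · filter_upwards [eventually_le_atBot α] with y hy
        have := hgrow hy
        simp only [hLα] at this
        linarith
      · exact tendsto_atBot_add_const_right _ _ (tendsto_id.const_mul_atBot two_pos)
  let e : ℝ ≃o ℝ := hLmono.orderIsoOfSurjective L hsurj
  have heL : ∀ y, e y = L y := fun y => rfl
  have hsymm : ∀ z, L (e.symm z) = z := fun z => e.apply_symm_apply z
  refine ⟨fun x => e.symm (K * x), ?_, ?_, ?_, fun x => ?_⟩
  · exact e.symm.strictMono.comp fun x y hxy => mul_lt_mul_of_pos_left hxy hKpos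
  · simp only [mul_zero]
    rw [← hLα, ← heL, e.symm_apply_apply]
  · simp only [mul_one]
    rw [← hLβ, ← heL, e.symm_apply_apply]
  · have h1 : HasDerivAt e.symm (1 / truncMin c (e.symm (K * x)))⁻¹ (K * x) :=
      HasDerivAt.of_local_left_inverse e.symm.continuous.continuousAt (hLd _)
        (one_div_pos.2 (truncMin_pos hcpos _)).ne' (Eventually.of_forall hsymm)
    refine (h1.comp x ((hasDerivAt_id x).const_mul K)).congr_deriv ?_
    simp only [one_div, inv_inv, mul_one]
    ring

/-- The step at the point where an increasing curve crosses the level `1/2`. -/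
theorem exists_crossing {F : ℝ → ℝ} (hF : StrictMono F) (hFc : Continuous F) :
    ∃ x₀ ∈ Icc (0 : ℝ) 1, ∀ x ∈ Ioo (0 : ℝ) 1,
      (x < x₀ → F x < 1 / 2) ∧ (x₀ < x → 1 / 2 < F x) := by
  by_cases h0 : 1 / 2 ≤ F 0
  · exact ⟨0, by simp, fun x hx => ⟨fun h => absurd h (not_lt.2 hx.1.le),
      fun h => h0.trans_lt (hF h)⟩⟩
  by_cases h1 : F 1 ≤ 1 / 2
  · exact ⟨1, by simp, fun x hx => ⟨fun h => (hF h).trans_le h1,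
      fun h => absurd h (not_lt.2 hx.2.le)⟩⟩
  obtain ⟨x₀, hx₀, he⟩ := intermediate_value_Icc zero_le_one hFc.continuousOn
    (show (1 / 2 : ℝ) ∈ Icc (F 0) (F 1) from ⟨(not_le.1 h0).le, (not_le.1 h1).le⟩)
  exact ⟨x₀, hx₀, fun x _ => ⟨fun h => he ▸ hF h, fun h => he ▸ hF h⟩⟩

/-! ### Step profiles -/

theorem indicator_mem_profiles (x₀ : ℝ) :
    (Icc 0 x₀).indicator (fun _ => (1 : ℝ)) ∈ profiles := by
  refine ⟨measurable_const.indicator measurableSet_Icc, fun x _ => ?_⟩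
  by_cases hx : x ∈ Icc 0 x₀ <;> simp [hx]

theorem stepProfiles_subset_profiles : stepProfiles ⊆ profiles := by
  rintro m ⟨x₀, -, rfl⟩
  exact indicator_mem_profiles x₀

theorem ae_ne_restrict (x₀ : ℝ) : ∀ᵐ x ∂(volume.restrict (Icc (0 : ℝ) 1)), x ≠ x₀ :=
  ae_restrict_of_ae (by simp [ae_iff, measure_singleton])

theorem indicator_ae_eq_imp {x₀ x₁ : ℝ} (h₀ : x₀ ∈ Icc (0 : ℝ) 1) (h₁ : x₁ ∈ Icc (0 : ℝ) 1)
    (h : (Icc 0 x₀).indicator (fun _ => (1 : ℝ)) =ᵐ[volume.restrict (Icc (0 : ℝ) 1)]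
      (Icc 0 x₁).indicator fun _ => (1 : ℝ)) : x₀ = x₁ := by
  wlog hlt : x₀ < x₁ generalizing x₀ x₁
  · rcases eq_or_lt_of_le (not_lt.1 hlt) with he | he
    · exact he.symm
    · exact (this h₁ h₀ h.symm he).symm
  exfalso
  have hsub : Ioo x₀ x₁ ⊆ Icc (0 : ℝ) 1 := fun x hx =>
    ⟨h₀.1.trans hx.1.le, hx.2.le.trans h₁.2⟩
  have hfalse : ∀ᵐ x ∂(volume.restrict (Ioo x₀ x₁)), False := by
    filter_upwards [ae_restrict_of_ae_restrict_of_subset hsub h,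
      ae_restrict_mem measurableSet_Ioo] with x hx hxI
    rw [indicator_of_notMem (fun hc => absurd hc.2 (not_le.2 hxI.1)),
      indicator_of_mem (show x ∈ Icc 0 x₁ from ⟨h₀.1.trans hxI.1.le, hxI.2.le⟩)] at hx
    exact zero_ne_one hx
  rw [eventually_false_iff_eq_bot, ae_eq_bot, Measure.restrict_eq_zero, Real.volume_Ioo,
    ENNReal.ofReal_eq_zero] at hfalse
  linarith

/-! ### The energy defect -/

/-- The nonnegative integrand of `E₊ - (V + S)(m)`. The first group of terms compares `m` with the
step at the level `F = 1/2`; the second, `g - 1 - log g` for the density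
`g = F' / (K min (F, 1 - F))`, whose integral is one, is the deficit in Jensen's inequality. -/
noncomputable def energyDefect (K : ℝ) (m F : ℝ → ℝ) (x : ℝ) : ℝ :=
  (m x * Real.log (F x) + (1 - m x) * Real.log (1 - F x) - Real.log (min (F x) (1 - F x))) +
    (derivUnit F x / (K * min (F x) (1 - F x)) - 1 -
      Real.log (derivUnit F x / (K * min (F x) (1 - F x))))

theorem sub_one_sub_log_nonneg {g : ℝ} (hg : 0 < g) : 0 ≤ g - 1 - Real.log g := by
  linarith [Real.log_le_sub_one_of_pos hg]

theorem sub_one_sub_log_eq_zero {g : ℝ} (hg : 0 < g) (h : g - 1 - Real.log g = 0) : g = 1 := by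
  by_contra hne
  linarith [Real.log_lt_sub_one_of_pos hg hne]

namespace IsBVPSolution

variable {α β : ℝ} {m F : ℝ → ℝ}

theorem mem_Ioo (h : IsBVPSolution α β m F) (hα : 0 < α) (hβ : β < 1) {x : ℝ}
    (hx : x ∈ Icc (0 : ℝ) 1) : F x ∈ Ioo (0 : ℝ) 1 :=
  ⟨hα.trans_le (h.mem_Icc hx).1, (h.mem_Icc hx).2.trans_lt hβ⟩

theorem min_pos (h : IsBVPSolution α β m F) (hα : 0 < α) (hβ : β < 1) {x : ℝ}
    (hx : x ∈ Icc (0 : ℝ) 1) : 0 < min (F x) (1 - F x) :=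
  lt_min (h.mem_Ioo hα hβ hx).1 (sub_pos.2 (h.mem_Ioo hα hβ hx).2)

theorem continuousOn_min (h : IsBVPSolution α β m F) :
    ContinuousOn (fun x => min (F x) (1 - F x)) (Icc 0 1) :=
  ContinuousOn.inf h.contDiffOn.continuousOn (continuousOn_const.sub h.contDiffOn.continuousOn)

/-- Change of variables `y = F x`. -/
theorem integral_derivUnit_div_min (h : IsBVPSolution α β m F) (hα : 0 < α) (hαβ : α ≤ β)
    (hβ : β < 1) :
    ∫ x in (0 : ℝ)..1, derivUnit F x / min (F x) (1 - F x) =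
      ∫ x in α..β, 1 / min x (1 - x) := by
  have hc : 0 < min α (1 - β) := lt_min hα (sub_pos.2 hβ)
  have hL := hasDerivAt_truncPotential hc α
  rw [← truncPotential_right hαβ]
  have e : truncPotential (min α (1 - β)) α β =
      truncPotential (min α (1 - β)) α (F 1) - truncPotential (min α (1 - β)) α (F 0) := by
    rw [h.left_bdry, h.right_bdry]
    simp [truncPotential]
  rw [e]
  refine intervalIntegral.integral_eq_sub_of_hasDerivAt_of_le zero_le_one
    (f := fun x => truncPotential (min α (1 - β)) α (F x)) ?_ (fun x hx => ?_) ?_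
  · exact (continuous_iff_continuousAt.2 fun y => (hL y).continuousAt).comp_continuousOn
      h.contDiffOn.continuousOn
  · have hxc := Ioo_subset_Icc_self hx
    have h1 := (hL (F x)).comp x ((h.hasDerivWithinAt hxc).hasDerivAt (Icc_mem_nhds hx.1 hx.2))
    refine h1.congr_deriv ?_
    rw [truncMin_eq (h.mem_Icc hxc)]
    ring
  · refine ContinuousOn.intervalIntegrable ?_
    rw [uIcc_of_le zero_le_one]
    exact h.continuousOn_derivUnit.div h.continuousOn_min fun x hx => (h.min_pos hα hβ hx).ne'

theorem profileEnergy_eq (h : IsBVPSolution α β m F) (hm : m ∈ profiles) (hα : 0 < α)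
    (hαβ : α < β) (hβ : β < 1) :
    profileEnergy α β m = ∫ x in (0 : ℝ)..1, (Real.log (derivUnit F x / (β - α)) -
      (m x * Real.log (F x) + (1 - m x) * Real.log (1 - F x))) := by
  have hu : uIcc (0 : ℝ) 1 = Icc 0 1 := uIcc_of_le zero_le_one
  have hF : IsBVPSolution α β m (bvpSolution α β m) := Classical.epsilon_spec ⟨F, h⟩
  have heq := hF.eqOn h hm hα hαβ hβ
  rw [profileEnergy, freeEnergy, if_neg hαβ.ne, ← integral_add_profileEntropy hm
    h.contDiffOn.continuousOn (fun x hx => h.mem_Ioo hα hβ hx) (ContinuousOn.intervalIntegrable ?_)]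
  · congr 1
    refine intervalIntegral.integral_congr fun x hx => ?_
    rw [hu] at hx
    simp only [heq hx, derivUnit_congr heq hx]
  · rw [hu]
    exact (h.continuousOn_derivUnit.div_const _).log fun x hx =>
      (div_pos (h.derivUnit_pos hm hα hαβ hβ hx) (sub_pos.2 hαβ)).ne'

theorem energyMax_sub_profileEnergy (h : IsBVPSolution α β m F) (hm : m ∈ profiles) (hα : 0 < α)
    (hαβ : α < β) (hβ : β < 1) :
    IntervalIntegrable (energyDefect (∫ x in α..β, 1 / min x (1 - x)) m F) volume 0 1 ∧
    energyMax α β - profileEnergy α β m =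
      ∫ x in (0 : ℝ)..1, energyDefect (∫ x in α..β, 1 / min x (1 - x)) m F x := by
  have hu : uIcc (0 : ℝ) 1 = Icc 0 1 := uIcc_of_le zero_le_one
  have hKpos := integral_inv_min_pos hα hαβ hβ
  have hint := h.integral_derivUnit_div_min hα hαβ.le hβ
  set K := ∫ x in α..β, 1 / min x (1 - x) with hK
  have hw := weighted_log_intervalIntegrable hm h.contDiffOn.continuousOn
    fun x hx => h.mem_Ioo hα hβ hx
  have hb : 0 < β - α := sub_pos.2 hαβ
  have hGpos := fun x hx => h.derivUnit_pos hm hα hαβ hβ (x := x) hx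
  have hqc : IntervalIntegrable (fun x => Real.log (derivUnit F x / (β - α))) volume 0 1 := by
    refine ContinuousOn.intervalIntegrable ?_
    rw [hu]
    exact (h.continuousOn_derivUnit.div_const _).log fun x hx => (div_pos (hGpos x hx) hb).ne'
  have hgi : IntervalIntegrable (fun x => derivUnit F x / min (F x) (1 - F x)) volume 0 1 := by
    refine ContinuousOn.intervalIntegrable ?_
    rw [hu]
    exact h.continuousOn_derivUnit.div h.continuousOn_min fun x hx => (h.min_pos hα hβ hx).ne'
  -- the defect, as a combination of integrable functions
  have hD : EqOn (fun x => (energyMax α β - 1 - (Real.log (derivUnit F x / (β - α)) -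
      (m x * Real.log (F x) + (1 - m x) * Real.log (1 - F x)))) +
      K⁻¹ * (derivUnit F x / min (F x) (1 - F x))) (energyDefect K m F) (uIcc 0 1) := by
    intro x hx
    rw [hu] at hx
    have h1 := hGpos x hx
    have h2 := h.min_pos hα hβ hx
    simp only [energyDefect, energyMax, if_neg hαβ.ne, ← hK]
    rw [Real.log_mul (by positivity) hKpos.ne', Real.log_div one_ne_zero hb.ne', Real.log_one,
      Real.log_div h1.ne' hb.ne', Real.log_div h1.ne' (by positivity),
      Real.log_mul hKpos.ne' h2.ne']
    field_simp
    ring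
  have hi1 : IntervalIntegrable (fun x => energyMax α β - 1 - (Real.log (derivUnit F x / (β - α)) -
      (m x * Real.log (F x) + (1 - m x) * Real.log (1 - F x)))) volume 0 1 :=
    intervalIntegrable_const.sub (hqc.sub hw)
  refine ⟨(hi1.add (hgi.const_mul K⁻¹)).congr (hD.mono uIoc_subset_uIcc), ?_⟩
  rw [← intervalIntegral.integral_congr hD, intervalIntegral.integral_add hi1 (hgi.const_mul K⁻¹),
    intervalIntegral.integral_const_mul, hint, inv_mul_cancel₀ hKpos.ne',
    intervalIntegral.integral_sub intervalIntegrable_const (hqc.sub hw),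
    ← h.profileEnergy_eq hm hα hαβ hβ]
  simp only [intervalIntegral.integral_const, sub_zero, one_smul]
  ring

theorem energyDefect_nonneg (h : IsBVPSolution α β m F) (hm : m ∈ profiles) (hα : 0 < α)
    (hαβ : α < β) (hβ : β < 1) {K : ℝ} (hK : 0 < K) {x : ℝ} (hx : x ∈ Icc (0 : ℝ) 1) :
    0 ≤ energyDefect K m F x :=
  add_nonneg (weighted_log_gap_nonneg (hm.2 x hx) (h.mem_Ioo hα hβ hx))
    (sub_one_sub_log_nonneg (div_pos (h.derivUnit_pos hm hα hαβ hβ hx)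
      (mul_pos hK (h.min_pos hα hβ hx))))

theorem of_energyDefect_eq_zero (h : IsBVPSolution α β m F) (hm : m ∈ profiles) (hα : 0 < α)
    (hαβ : α < β) (hβ : β < 1) {K : ℝ} (hK : 0 < K) {x : ℝ} (hx : x ∈ Icc (0 : ℝ) 1)
    (h0 : energyDefect K m F x = 0) :
    derivUnit F x = K * min (F x) (1 - F x) ∧ (F x < 1 / 2 → m x = 1) ∧
      (1 / 2 < F x → m x = 0) := by
  have hd := mul_pos hK (h.min_pos hα hβ hx)
  have hg := div_pos (h.derivUnit_pos hm hα hαβ hβ hx) hd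
  have e1 := weighted_log_gap_nonneg (hm.2 x hx) (h.mem_Ioo hα hβ hx)
  have e2 := sub_one_sub_log_nonneg hg
  rw [energyDefect] at h0
  refine ⟨?_, weighted_log_gap_eq_zero (h.mem_Ioo hα hβ hx) (by linarith)⟩
  exact (div_eq_one_iff_eq hd.ne').1 (sub_one_sub_log_eq_zero hg (by linarith))

end IsBVPSolution

/-! ### Maximizers out of equilibrium -/

/-- An extremal curve solves the boundary value problem of its own step at the level `1/2`. -/
theorem isBVPSolution_extremal {α β K x₀ : ℝ} {F m : ℝ → ℝ} (hα : 0 < α) (hβ : β < 1)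
    (hFmono : StrictMono F) (hF0 : F 0 = α) (hF1 : F 1 = β)
    (hFd : ∀ x, HasDerivAt F (K * truncMin (min α (1 - β)) (F x)) x)
    (hcross : ∀ x ∈ Ioo (0 : ℝ) 1, (x < x₀ → F x < 1 / 2) ∧ (x₀ < x → 1 / 2 < F x))
    (hm : ∀ x ∈ Ioo (0 : ℝ) 1, (x < x₀ → m x = 1) ∧ (x₀ < x → m x = 0)) :
    IsBVPSolution α β m F ∧ ∀ x ∈ Icc (0 : ℝ) 1, derivUnit F x = K * min (F x) (1 - F x) := by
  have hu : uIcc (0 : ℝ) 1 = Icc 0 1 := uIcc_of_le zero_le_one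
  have hFc : Continuous F := continuous_iff_continuousAt.2 fun x => (hFd x).continuousAt
  have hlip := lipschitzWith_truncMin (min α (1 - β))
  have hmem : ∀ x ∈ Icc (0 : ℝ) 1, F x ∈ Icc α β := fun x hx => by
    rw [← hF0, ← hF1]
    exact ⟨hFmono.monotone hx.1, hFmono.monotone hx.2⟩
  have hGt : ∀ x ∈ Icc (0 : ℝ) 1, derivUnit F x = K * truncMin (min α (1 - β)) (F x) :=
    fun x hx => derivUnit_eq hx (hFd x).hasDerivWithinAt
  have hG : ∀ x ∈ Icc (0 : ℝ) 1, derivUnit F x = K * min (F x) (1 - F x) := fun x hx => by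
    rw [hGt x hx, truncMin_eq (hmem x hx)]
  have hFcd : ContDiffOn ℝ 1 F (Icc 0 1) := contDiffOn_one_Icc
    (fun x _ => (hFd x).hasDerivWithinAt)
    (continuous_const.mul (hlip.continuous.comp hFc)).continuousOn
  refine ⟨⟨hFcd, hFmono.monotone.monotoneOn _, ?_, ?_, hF0, hF1⟩, hG⟩
  · have hFac : AbsolutelyContinuousOnInterval F 0 1 :=
      ContDiffOn.absolutelyContinuousOnInterval (by rwa [hu])
    refine ((hFac.lipschitzOnWith_comp hlip.lipschitzOnWith
      (mapsTo_univ _ _)).const_mul K).congr_uIcc fun x hx => (hGt x (hu ▸ hx)).symm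
  · filter_upwards [ae_mem_Ioo, ae_ne_restrict x₀] with x hxI hne
    have hxc := Ioo_subset_Icc_self hxI
    have hFx := hmem x hxc
    have e0 : F x ≠ 0 := (hα.trans_le hFx.1).ne'
    have e1 : 1 - F x ≠ 0 := (sub_pos.2 (hFx.2.trans_lt hβ)).ne'
    have hd : HasDerivAt F (derivUnit F x) x := by rw [hGt x hxc]; exact hFd x
    rcases lt_or_gt_of_ne hne with hlt | hlt
    · have hhalf := (hcross x hxI).1 hlt
      have heq : derivUnit F =ᶠ[𝓝 x] fun y => K * F y := by
        filter_upwards [Icc_mem_nhds hxI.1 hxI.2, hFc.continuousAt.eventually_lt_const hhalf]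
          with y hy hy2
        rw [hG y hy, min_eq_left (by linarith)]
      refine ((hd.const_mul K).congr_of_eventuallyEq heq).congr_deriv ?_
      rw [(hm x hxI).1 hlt, hG x hxc, min_eq_left (by linarith)]
      field_simp
    · have hhalf := (hcross x hxI).2 hlt
      have heq : derivUnit F =ᶠ[𝓝 x] fun y => K * (1 - F y) := by
        filter_upwards [Icc_mem_nhds hxI.1 hxI.2, hFc.continuousAt.eventually_const_lt hhalf]
          with y hy hy2
        rw [hG y hy, min_eq_right (by linarith)]
      refine (((hd.const_sub 1).const_mul K).congr_of_eventuallyEq heq).congr_deriv ?_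
      rw [(hm x hxI).2 hlt, hG x hxc, min_eq_right (by linarith)]
      field_simp
      ring

theorem indicator_eq_of_mem_Ioo (x₀ : ℝ) : ∀ x ∈ Ioo (0 : ℝ) 1,
    (x < x₀ → (Icc 0 x₀).indicator (fun _ => (1 : ℝ)) x = 1) ∧
      (x₀ < x → (Icc 0 x₀).indicator (fun _ => (1 : ℝ)) x = 0) :=
  fun _ hx => ⟨fun h => indicator_of_mem (show _ ∈ Icc 0 x₀ from ⟨hx.1.le, h.le⟩) _,
    fun h => indicator_of_notMem (fun hc => absurd hc.2 (not_le.2 h)) _⟩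

theorem profileEnergy_le_of_lt {α β : ℝ} (hα : 0 < α) (hαβ : α < β) (hβ : β < 1) {m : ℝ → ℝ}
    (hm : m ∈ profiles) : profileEnergy α β m ≤ energyMax α β := by
  obtain ⟨F, h⟩ := exists_isBVPSolution hα hαβ hβ hm
  have h1 := (h.energyMax_sub_profileEnergy hm hα hαβ hβ).2
  have h2 := intervalIntegral.integral_nonneg (μ := volume) zero_le_one fun x hx =>
    h.energyDefect_nonneg hm hα hαβ hβ (integral_inv_min_pos hα hαβ hβ) hx
  linarith

/-- The step of the extremal curve has zero defect. Conversely, zero defect forces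
`F' = K min (F, 1 - F)`, hence `F` is the extremal curve and `m` its step. -/
theorem exists_step_maximizer_of_lt {α β : ℝ} (hα : 0 < α) (hαβ : α < β) (hβ : β < 1) :
    ∃ x₀ ∈ Icc (0 : ℝ) 1,
      profileEnergy α β ((Icc 0 x₀).indicator fun _ => 1) = energyMax α β ∧
      ∀ m ∈ profiles, profileEnergy α β m = energyMax α β →
        m =ᵐ[volume.restrict (Icc (0 : ℝ) 1)] (Icc 0 x₀).indicator fun _ => 1 := by
  obtain ⟨F, hFmono, hF0, hF1, hFd⟩ := exists_extremal hα hαβ hβ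
  have hKpos := integral_inv_min_pos hα hαβ hβ
  have hFc : Continuous F := continuous_iff_continuousAt.2 fun x => (hFd x).continuousAt
  obtain ⟨x₀, hx₀, hcross⟩ := exists_crossing hFmono hFc
  have hstep := indicator_eq_of_mem_Ioo x₀
  set m₀ : ℝ → ℝ := (Icc 0 x₀).indicator fun _ => 1 with hm₀def
  have hm₀ : m₀ ∈ profiles := indicator_mem_profiles x₀
  obtain ⟨hF, hFG⟩ := isBVPSolution_extremal hα hβ hFmono hF0 hF1 hFd hcross hstep
  refine ⟨x₀, hx₀, ?_, fun m hm hmax => ?_⟩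
  · obtain ⟨hi, he⟩ := hF.energyMax_sub_profileEnergy hm₀ hα hαβ hβ
    have hz := (integral_eq_zero_iff_ae_Icc hi
      fun x hx => hF.energyDefect_nonneg hm₀ hα hαβ hβ hKpos hx).2 ?_
    · linarith
    · filter_upwards [ae_mem_Ioo, ae_ne_restrict x₀] with x hxI hne
      have hxc := Ioo_subset_Icc_self hxI
      have hd := mul_pos hKpos (hF.min_pos hα hβ hxc)
      rw [energyDefect, hFG x hxc, div_self hd.ne', Real.log_one]
      rcases lt_or_gt_of_ne hne with hlt | hlt
      · rw [(hstep x hxI).1 hlt, min_eq_left (by linarith [(hcross x hxI).1 hlt])]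
        ring
      · rw [(hstep x hxI).2 hlt, min_eq_right (by linarith [(hcross x hxI).2 hlt])]
        ring
  · obtain ⟨G, hG⟩ := exists_isBVPSolution hα hαβ hβ hm
    obtain ⟨hi, he⟩ := hG.energyMax_sub_profileEnergy hm hα hαβ hβ
    rw [hmax, sub_self] at he
    have hz := (integral_eq_zero_iff_ae_Icc hi
      fun x hx => hG.energyDefect_nonneg hm hα hαβ hβ hKpos hx).1 he.symm
    have hGd : EqOn (derivUnit G) (fun x => (∫ x in α..β, 1 / min x (1 - x)) *
        min (G x) (1 - G x)) (Icc 0 1) := by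
      refine Measure.eqOn_Icc_of_ae_eq volume zero_ne_one ?_ hG.continuousOn_derivUnit
        (continuousOn_const.mul hG.continuousOn_min)
      filter_upwards [hz, ae_restrict_mem measurableSet_Icc] with x hx hxc
      exact (hG.of_energyDefect_eq_zero hm hα hαβ hβ hKpos hxc hx).1
    set K := ∫ x in α..β, 1 / min x (1 - x) with hK
    -- both curves solve the same Cauchy problem
    have hGF : EqOn G F (Icc 0 1) := by
      refine ODE_solution_unique (v := fun _ y => K * truncMin (min α (1 - β)) y)
        (K := K.toNNReal) (fun _ => ?_) hG.contDiffOn.continuousOn (fun x hx => ?_)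
        hFc.continuousOn (fun x _ => (hFd x).hasDerivWithinAt) (by rw [hG.left_bdry, hF0])
      · refine LipschitzWith.of_dist_le_mul fun y z => ?_
        have := (lipschitzWith_truncMin (min α (1 - β))).dist_le_mul y z
        rw [NNReal.coe_one, one_mul] at this
        rw [Real.dist_eq, ← mul_sub, abs_mul, abs_of_pos hKpos, Real.coe_toNNReal _ hKpos.le,
          ← Real.dist_eq]
        gcongr
      · have hxc := Ico_subset_Icc_self hx
        have h1 := hG.hasDerivWithinAt hxc
        rw [hGd hxc] at h1
        rw [truncMin_eq (hG.mem_Icc hxc)]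
        exact h1.mono_of_mem_nhdsWithin (Icc_mem_nhdsGE_of_mem hx)
    filter_upwards [hz, ae_mem_Ioo, ae_ne_restrict x₀] with x hx hxI hne
    have hxc := Ioo_subset_Icc_self hxI
    obtain ⟨-, e1, e2⟩ := hG.of_energyDefect_eq_zero hm hα hαβ hβ hKpos hxc hx
    rw [hGF hxc] at e1 e2
    rcases lt_or_gt_of_ne hne with hlt | hlt
    · exact (e1 ((hcross x hxI).1 hlt)).trans ((hstep x hxI).1 hlt).symm
    · exact (e2 ((hcross x hxI).2 hlt)).trans ((hstep x hxI).2 hlt).symm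

/-! ### Maximizers at equilibrium -/

theorem energyMax_sub_profileEnergy_self {α : ℝ} (hα : α ∈ Ioo (0 : ℝ) 1) {m : ℝ → ℝ}
    (hm : m ∈ profiles) :
    IntervalIntegrable (fun x => m x * Real.log α + (1 - m x) * Real.log (1 - α) -
      Real.log (min α (1 - α))) volume 0 1 ∧
    energyMax α α - profileEnergy α α m =
      ∫ x in (0 : ℝ)..1, (m x * Real.log α + (1 - m x) * Real.log (1 - α) -
        Real.log (min α (1 - α))) := by
  have hw := weighted_log_intervalIntegrable (F := fun _ => α) hm continuousOn_const fun _ _ => hα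
  have h := integral_add_profileEntropy (F := fun _ => α) (q := fun _ => 0) hm continuousOn_const
    (fun _ _ => hα) intervalIntegrable_const
  simp only [add_zero, zero_sub, intervalIntegral.integral_neg] at h
  refine ⟨hw.sub intervalIntegrable_const, ?_⟩
  rw [intervalIntegral.integral_sub hw intervalIntegrable_const, profileEnergy, freeEnergy,
    if_pos rfl, h, energyMax, if_pos rfl]
  simp
  ring

theorem profileEnergy_le_self {α : ℝ} (hα : α ∈ Ioo (0 : ℝ) 1) {m : ℝ → ℝ}
    (hm : m ∈ profiles) : profileEnergy α α m ≤ energyMax α α := by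
  have h1 := (energyMax_sub_profileEnergy_self hα hm).2
  have h2 := intervalIntegral.integral_nonneg (μ := volume) zero_le_one fun x hx =>
    weighted_log_gap_nonneg (hm.2 x hx) hα
  linarith

theorem exists_step_maximizer_self {α : ℝ} (hα : α ∈ Ioo (0 : ℝ) 1) :
    ∃ x₀ ∈ Icc (0 : ℝ) 1,
      profileEnergy α α ((Icc 0 x₀).indicator fun _ => 1) = energyMax α α ∧
      (α ≠ 1 / 2 → ∀ m ∈ profiles, profileEnergy α α m = energyMax α α →
        m =ᵐ[volume.restrict (Icc (0 : ℝ) 1)] (Icc 0 x₀).indicator fun _ => 1) := by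
  obtain ⟨x₀, hx₀, hcross⟩ : ∃ x₀ ∈ Icc (0 : ℝ) 1, ∀ x ∈ Ioo (0 : ℝ) 1,
      (x < x₀ ∧ α ≤ 1 / 2) ∨ (x₀ < x ∧ 1 / 2 ≤ α) := by
    rcases le_total α (1 / 2) with h | h
    · exact ⟨1, by simp, fun x hx => Or.inl ⟨hx.2, h⟩⟩
    · exact ⟨0, by simp, fun x hx => Or.inr ⟨hx.1, h⟩⟩
  have hstep := indicator_eq_of_mem_Ioo x₀
  refine ⟨x₀, hx₀, ?_, fun hne m hm hmax => ?_⟩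
  · obtain ⟨hi, he⟩ := energyMax_sub_profileEnergy_self hα (indicator_mem_profiles x₀)
    have hz := (integral_eq_zero_iff_ae_Icc hi fun x hx =>
      weighted_log_gap_nonneg ((indicator_mem_profiles x₀).2 x hx) hα).2 ?_
    · linarith
    · filter_upwards [ae_mem_Ioo] with x hxI
      rcases hcross x hxI with ⟨hlt, h⟩ | ⟨hlt, h⟩
      · rw [(hstep x hxI).1 hlt, min_eq_left (by linarith)]
        ring
      · rw [(hstep x hxI).2 hlt, min_eq_right (by linarith)]
        ring
  · obtain ⟨hi, he⟩ := energyMax_sub_profileEnergy_self hα hm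
    rw [hmax, sub_self] at he
    have hz := (integral_eq_zero_iff_ae_Icc hi fun x hx =>
      weighted_log_gap_nonneg (hm.2 x hx) hα).1 he.symm
    filter_upwards [hz, ae_mem_Ioo] with x hx hxI
    obtain ⟨e1, e2⟩ := weighted_log_gap_eq_zero hα hx
    rcases hcross x hxI with ⟨hlt, h⟩ | ⟨hlt, h⟩
    · rw [(hstep x hxI).1 hlt, e1 (lt_of_le_of_ne h hne)]
    · rw [(hstep x hxI).2 hlt, e2 (lt_of_le_of_ne h hne.symm)]

theorem isBVPSolution_const (α : ℝ) (m : ℝ → ℝ) : IsBVPSolution α α m fun _ => α := by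
  have hd : derivUnit (fun _ => α) = fun _ => 0 := by
    funext x
    simp [derivUnit]
  refine ⟨contDiffOn_const, monotoneOn_const, ?_, ?_, rfl, rfl⟩
  · rw [hd]
    exact (LipschitzWith.const (0 : ℝ)).lipschitzOnWith.absolutelyContinuousOnInterval
  · rw [hd]
    refine Eventually.of_forall fun x => ?_
    simpa using hasDerivAt_const x (0 : ℝ)

/-! ### The energy band -/

/-- For `0 < α ≤ β < 1`: the boundary value problem that enters the definition of `V` is uniquely
solvable for each profile; the supremum of `V + S` over all profiles and over the step profiles
is `E₊`; it is attained at a step profile; and, unless `α = β = 1/2` (where `V + S` is constant),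
this step profile is unique, and it is, up to null sets, the only maximizer among all profiles. -/
theorem lemmas03 (α β : ℝ) (hα : 0 < α) (hαβ : α ≤ β) (hβ : β < 1) :
    (∀ m ∈ profiles, ∃ F : ℝ → ℝ, IsBVPSolution α β m F ∧
      ∀ G : ℝ → ℝ, IsBVPSolution α β m G → Set.EqOn G F (Set.Icc 0 1)) ∧
    IsLUB (profileEnergy α β '' profiles) (energyMax α β) ∧
    IsLUB (profileEnergy α β '' stepProfiles) (energyMax α β) ∧
    (∃ m ∈ stepProfiles, profileEnergy α β m = energyMax α β) ∧
    (¬ (α = 1 / 2 ∧ β = 1 / 2) →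
      ∃ m ∈ stepProfiles, profileEnergy α β m = energyMax α β ∧
        (∀ m' ∈ stepProfiles, profileEnergy α β m' = energyMax α β → m' = m) ∧
        (∀ m' ∈ profiles, profileEnergy α β m' = energyMax α β →
          m' =ᵐ[MeasureTheory.volume.restrict (Set.Icc (0 : ℝ) 1)] m)) := by
  have hsolve : ∀ m ∈ profiles, ∃ F : ℝ → ℝ, IsBVPSolution α β m F ∧
      ∀ G : ℝ → ℝ, IsBVPSolution α β m G → EqOn G F (Icc 0 1) := by
    intro m hm
    rcases hαβ.lt_or_eq with hlt | rfl
    · obtain ⟨F, hF⟩ := exists_isBVPSolution hα hlt hβ hm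
      exact ⟨F, hF, fun G hG => hG.eqOn hF hm hα hlt hβ⟩
    · refine ⟨fun _ => α, isBVPSolution_const α m, fun G hG x hx => ?_⟩
      exact le_antisymm (hG.mem_Icc hx).2 (hG.mem_Icc hx).1
  have hle : ∀ m ∈ profiles, profileEnergy α β m ≤ energyMax α β := by
    intro m hm
    rcases hαβ.lt_or_eq with hlt | rfl
    · exact profileEnergy_le_of_lt hα hlt hβ hm
    · exact profileEnergy_le_self ⟨hα, hβ⟩ hm
  obtain ⟨x₀, hx₀, hmax, huniq⟩ : ∃ x₀ ∈ Icc (0 : ℝ) 1,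
      profileEnergy α β ((Icc 0 x₀).indicator fun _ => 1) = energyMax α β ∧
      (¬ (α = 1 / 2 ∧ β = 1 / 2) → ∀ m ∈ profiles, profileEnergy α β m = energyMax α β →
        m =ᵐ[volume.restrict (Icc (0 : ℝ) 1)] (Icc 0 x₀).indicator fun _ => 1) := by
    rcases hαβ.lt_or_eq with hlt | rfl
    · obtain ⟨x₀, hx₀, h1, h2⟩ := exists_step_maximizer_of_lt hα hlt hβ
      exact ⟨x₀, hx₀, h1, fun _ => h2⟩
    · obtain ⟨x₀, hx₀, h1, h2⟩ := exists_step_maximizer_self ⟨hα, hβ⟩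
      exact ⟨x₀, hx₀, h1, fun hne => h2 fun h => hne ⟨h, h⟩⟩
  set m₀ : ℝ → ℝ := (Icc 0 x₀).indicator fun _ => 1 with hm₀
  have hstep : m₀ ∈ stepProfiles := ⟨x₀, hx₀, rfl⟩
  refine ⟨hsolve, ?_, ?_, ⟨m₀, hstep, hmax⟩, fun hne => ⟨m₀, hstep, hmax, ?_, huniq hne⟩⟩
  · refine IsGreatest.isLUB ⟨⟨m₀, stepProfiles_subset_profiles hstep, hmax⟩, ?_⟩
    rintro _ ⟨m, hm, rfl⟩
    exact hle m hm
  · refine IsGreatest.isLUB ⟨⟨m₀, hstep, hmax⟩, ?_⟩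
    rintro _ ⟨m, hm, rfl⟩
    exact hle m (stepProfiles_subset_profiles hm)
  · rintro m hm hmE
    have hae := huniq hne m (stepProfiles_subset_profiles hm) hmE
    obtain ⟨x₁, hx₁, rfl⟩ := hm
    rw [hm₀, indicator_ae_eq_imp hx₁ hx₀ hae]
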